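/- For graphs $G_1,\dots,G_d$ with anchor sets $S_j\subseteq V(G_j)$, the anchored product $(G_1,S_1)\boxplus\cdots\boxplus(G_d,S_d)$ is the graph whose vertices are the tuples $(v_1,\dots,v_d)\in V(G_1)\times\cdots\times V(G_d)$ with at most one coordinate $v_j\notin S_j$, two vertices being adjacent when they differ in exactly one coordinate $j$, their $j$-th coordinates are adjacent in $G_j$, and all other (common) coordinates $v_k$ lie in $S_k$. (Up to isomorphism the order of the factors does not matter.) A graph $H$ decomposes $G$ if $G$ is the union of finitely many pairwise edge-disjoint subgraphs, each isomorphic to $H$. $C_b$ is the cycle of length $b$. Let $d\ge 2$ and let $a=2^{i_1}+2^{i_2}+\cdots+2^{i_d}$ be odd with integers $i_1>i_2>\cdots>i_d=0$. For $1\le j\le d$ let $y_j^*\ge 4$ be a power of two such that $z_j:=y_j^*2^{-i_j}$ is an even integer, and let $S_j$ consist of every $2^{i_j}$-th vertex of $C_{y_j^*}$ (so $S_d=V(C_{y_d^*})$). For $1\le k\le d$ put $$\alpha_k=\sum_{j=1}^{k-1}\log_2 z_j+\log_2 z_d-(k-1),$$ and let $\alpha$ be an integer with $\alpha_1\le\alpha\le\alpha_d$.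 Write $\eta(y,c)=1$ if $y>c$ and $\eta(y,c)=0$ otherwise, $\eta_{\alpha_k}=\eta(\alpha,\alpha_k)$, $A_2=\eta(\alpha+1,\alpha_2)$, $$A_3=2^{(1-A_2)(\alpha-\alpha_1)+A_2(\alpha_2-\alpha_1)+1},\qquad A_k=2^{(1-\eta_{\alpha_{k-1}})(\alpha-\alpha_{k-2})\eta_{\alpha_{k-2}}+\eta_{\alpha_{k-1}}(\alpha_{k-1}-\alpha_{k-2})}\quad(4\le k\le d+1).$$ Suppose that $4\mid y_d^*$, that $A_3 2^{i_1}\mid y_1^*$, and that $A_{j+2}2^{i_j+1}\mid y_j^*$ for all $2\le j\le d-1$ (no condition of this last kind when $d=2$). Then $C_{a\cdot 2^\alpha}$ decomposes $(C_{y_1^*},S_1)\boxplus(C_{y_d^*},S_d)$ when $d=2$, and $(C_{y_1^*},S_1)\boxplus(C_{y_d^*},S_d)\boxplus\cdots\boxplus(C_{y_2^*},S_2)$ when $d\ge3$. -/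

import Mathlib

/-- The anchored product of two graphs `G₁`, `G₂` with anchor sets `S₁`, `S₂`: its vertices are the
pairs with at least one coordinate in the respective anchor set, and two vertices are adjacent when
they differ along an edge of one factor while the other coordinate is fixed and lies in its anchor
set. -/
def anchoredProd₂ {V₁ V₂ : Type} (G₁ : SimpleGraph V₁) (S₁ : Set V₁)
    (G₂ : SimpleGraph V₂) (S₂ : Set V₂) :
    SimpleGraph {p : V₁ × V₂ // p.1 ∈ S₁ ∨ p.2 ∈ S₂} where
  Adj p q := (G₁.Adj p.1.1 q.1.1 ∧ p.1.2 = q.1.2 ∧ p.1.2 ∈ S₂) ∨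
    (G₂.Adj p.1.2 q.1.2 ∧ p.1.1 = q.1.1 ∧ p.1.1 ∈ S₁)
  symm := ⟨by
    rintro p q (⟨h, e, m⟩ | ⟨h, e, m⟩)
    · exact Or.inl ⟨h.symm, e.symm, e ▸ m⟩
    · exact Or.inr ⟨h.symm, e.symm, e ▸ m⟩⟩
  loopless := ⟨by
    rintro p (⟨h, -, -⟩ | ⟨h, -, -⟩) <;> exact h.ne rfl⟩

/-- The vertices of an anchored product of several factors: tuples with at most one coordinate
outside its anchor set. -/
abbrev AnchoredVertex {ι : Type} {V : ι → Type} (S : ∀ j, Set (V j)) : Type :=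
  {v : ∀ j, V j // ∀ j k, j ≠ k → v j ∈ S j ∨ v k ∈ S k}

/-- The anchored product of a family of graphs `G j` with anchor sets `S j`: two vertices are
adjacent when they differ along an edge of one factor, while all other coordinates are fixed and lie
in their anchor sets. Up to isomorphism this is the iterated binary anchored product, in any order
of the factors, where the anchor set of a product is the product of the anchor sets; see
`anchoredProd_succ` and `anchoredProd_reindex`. -/
def anchoredProd {ι : Type} {V : ι → Type} (G : ∀ j, SimpleGraph (V j)) (S : ∀ j, Set (V j)) :
    SimpleGraph (AnchoredVertex S) where
  Adj u v := ∃ j, (G j).Adj (u.1 j) (v.1 j) ∧ ∀ k, k ≠ j → u.1 k = v.1 k ∧ u.1 k ∈ S k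
  symm := ⟨by
    rintro u v ⟨j, h, H⟩
    exact ⟨j, h.symm, fun k hk => ⟨(H k hk).1.symm, (H k hk).1 ▸ (H k hk).2⟩⟩⟩
  loopless := ⟨by
    rintro u ⟨j, h, -⟩
    exact h.ne rfl⟩

/-- Splitting off the first factor of an anchored product: what remains is a binary anchored
product, whose second factor carries the product of the remaining anchor sets. -/
theorem anchoredProd_succ {n : ℕ} {V : Fin (n + 1) → Type}
    (G : ∀ j, SimpleGraph (V j)) (S : ∀ j, Set (V j)) :
    Nonempty (anchoredProd G S ≃g
      anchoredProd₂ (G 0) (S 0)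
        (anchoredProd (fun j : Fin n => G j.succ) (fun j : Fin n => S j.succ))
        {v | ∀ j, v.1 j ∈ S j.succ}) := by
  refine ⟨⟨⟨fun v => ⟨(v.1 0, ⟨fun j => v.1 j.succ, fun j k h =>
      v.2 _ _ (fun e => h (Fin.succ_injective _ e))⟩), ?_⟩,
    fun p => ⟨Fin.cons p.1.1 p.1.2.1, ?_⟩, ?_, ?_⟩, ?_⟩⟩
  · by_cases h : v.1 0 ∈ S 0
    · exact Or.inl h
    · exact Or.inr fun j => (v.2 0 j.succ (Fin.succ_ne_zero j).symm).resolve_left h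
  · intro j k
    refine Fin.cases ?_ (fun j => ?_) j <;> refine Fin.cases ?_ (fun k => ?_) k
    · simp
    · intro _
      rcases p.2 with h | h
      · exact Or.inl (by simpa using h)
      · exact Or.inr (by simpa using h k)
    · intro _
      rcases p.2 with h | h
      · exact Or.inr (by simpa using h)
      · exact Or.inl (by simpa using h j)
    · intro h
      simpa using p.1.2.2 j k (fun e => h (e ▸ rfl))
  · intro v
    apply Subtype.ext
    funext j
    refine Fin.cases ?_ (fun j => ?_) j <;> simp
  · intro p
    apply Subtype.ext
    apply Prod.ext
    · simp
    · apply Subtype.ext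
      funext j
      simp
  · intro u v
    constructor
    · rintro (⟨h, e, m⟩ | ⟨⟨j, h, H⟩, e, m⟩)
      · refine ⟨0, h, fun k => Fin.cases (fun h => (h rfl).elim) (fun k _ => ?_) k⟩
        exact ⟨congrFun (congrArg Subtype.val e) k, m k⟩
      · refine ⟨j.succ, h, fun k => Fin.cases (fun _ => ⟨e, m⟩) (fun k hk => ?_) k⟩
        exact H k (fun e => hk (e ▸ rfl))
    · rintro ⟨j, h, H⟩
      revert h H
      refine Fin.cases ?_ (fun j => ?_) j
      · intro h H
        exact Or.inl ⟨h, Subtype.ext (funext fun k => (H k.succ (Fin.succ_ne_zero k)).1),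
          fun k => (H k.succ (Fin.succ_ne_zero k)).2⟩
      · intro h H
        exact Or.inr ⟨⟨j, h, fun k hk => H k.succ (fun e => hk (Fin.succ_injective _ e))⟩,
          H 0 (Fin.succ_ne_zero j).symm⟩

/-- The anchored product does not depend on the order of its factors. -/
theorem anchoredProd_reindex {ι κ : Type} (e : κ ≃ ι) {V : ι → Type}
    (G : ∀ j, SimpleGraph (V j)) (S : ∀ j, Set (V j)) :
    Nonempty (anchoredProd G S ≃g anchoredProd (fun k => G (e k)) (fun k => S (e k))) := by
  refine ⟨⟨(Equiv.piCongrLeft V e).symm.subtypeEquiv fun v => ?_, ?_⟩⟩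
  · constructor
    · intro h j k hjk
      exact h (e j) (e k) (fun h' => hjk (e.injective h'))
    · intro h j k hjk
      obtain ⟨j, rfl⟩ := e.surjective j
      obtain ⟨k, rfl⟩ := e.surjective k
      exact h j k (fun h' => hjk (h' ▸ rfl))
  · intro u v
    constructor
    · rintro ⟨j, h, H⟩
      refine ⟨e j, h, fun k hk => ?_⟩
      obtain ⟨k, rfl⟩ := e.surjective k
      exact H k (fun h' => hk (h' ▸ rfl))
    · rintro ⟨j, h, H⟩
      obtain ⟨j, rfl⟩ := e.surjective j
      exact ⟨j, h, fun k hk => H (e k) (fun h' => hk (e.injective h'))⟩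

/-- `H` decomposes `G`: finitely many subgraphs of `G`, each isomorphic to `H` and pairwise without
common edges, have union `G`. -/
def Decomposes {W V : Type} (H : SimpleGraph W) (G : SimpleGraph V) : Prop :=
  ∃ (k : ℕ) (F : Fin k → G.Subgraph), 0 < k ∧
    (∀ r, Nonempty (H ≃g (F r).coe)) ∧
    (∀ r s, r ≠ s → Disjoint (F r).edgeSet (F s).edgeSet) ∧
    (⨆ r, F r) = ⊤

/-- Every `m`-th vertex of the cycle of length `n`. -/
def everyNth (n m : ℕ) : Set (Fin n) := {v | m ∣ (v : ℕ)}

/-- The indicator `η(y, c)` of `y > c`. -/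
def etaInd (y c : ℕ) : ℕ := if c < y then 1 else 0

/-- `α_k = ∑_{j=1}^{k-1} log₂ z_j + log₂ z_d - (k - 1)`. When all `z_j` are powers of two that are at
least two and `1 ≤ k ≤ d`, the subtraction does not truncate. -/
def alphaMax (d : ℕ) (z : ℕ → ℕ) (k : ℕ) : ℕ :=
  (∑ j ∈ Finset.Icc 1 (k - 1), Nat.log 2 (z j)) + Nat.log 2 (z d) - (k - 1)

/-- `A_2 = η(α + 1, α_2)`. -/
def A2 (d : ℕ) (z : ℕ → ℕ) (α : ℕ) : ℕ := etaInd (α + 1) (alphaMax d z 2)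

/-- `A_3 = 2^{(1 - A_2)(α - α_1) + A_2 (α_2 - α_1) + 1}`. When the `z_j` are powers of two that are at
least two and `α_1 ≤ α`, no subtraction truncates. -/
def A3 (d : ℕ) (z : ℕ → ℕ) (α : ℕ) : ℕ :=
  2 ^ ((1 - A2 d z α) * (α - alphaMax d z 1) +
    A2 d z α * (alphaMax d z 2 - alphaMax d z 1) + 1)

/-- `A_k = 2^{(1 - η_{α_{k-1}}) (α - α_{k-2}) η_{α_{k-2}} + η_{α_{k-1}} (α_{k-1} - α_{k-2})}` for
`4 ≤ k`, where `η_{α_k} = η(α, α_k)`. When the `z_j` are powers of two that are at least two, a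
subtraction truncates only where it is multiplied by zero. -/
def AFactor (d : ℕ) (z : ℕ → ℕ) (α k : ℕ) : ℕ :=
  2 ^ ((1 - etaInd α (alphaMax d z (k - 1))) * (α - alphaMax d z (k - 2)) *
      etaInd α (alphaMax d z (k - 2)) +
    etaInd α (alphaMax d z (k - 1)) * (alphaMax d z (k - 1) - alphaMax d z (k - 2)))

/-!
Decompositions into cycles whose anchors partition the anchor set can be composed and multiplied, so
the factors can be combined one at a time, and everything reduces to the anchored product of two
cycles with `2 ^ E` and `2 ^ t` anchors at distances `a` and `b`. This is a toroidal `2 ^ E × 2 ^ t`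
grid with horizontal edges subdivided into `a` and vertical ones into `b` edges, so a closed
trajectory with `r` horizontal and `r` vertical steps is a cycle of length `r * (a + b)`.
Periodic direction fields tile the grid by such trajectories. Strips have `r = 2 ^ E` and spirals
`r = 2 ^ (E + t - 1)`; in both, horizontal and vertical steps alternate, so the lattice points can
be divided among the cycles as anchors at distance `a + b`, and the next factor can be attached.
Serpents attain every power of two in between, but without equidistant anchors, so they serve only
for the last factor. Strips or spirals for all factors but one, and a serpent for the last, reach
every exponent between the two extremes.
-/

open SimpleGraph Set

section Tilings

variable {U V W : Type*} {I J : Type*}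

/-- The copies `φ i` of the tile `T` in `G` use every edge of `G` exactly once. Disjointness is
expressed for ordered edges, which is the same since adjacency is symmetric. -/
structure IsTiling (T : SimpleGraph U) (G : SimpleGraph V) (φ : I → U → V) : Prop where
  adj : ∀ i {u v}, T.Adj u v → G.Adj (φ i u) (φ i v)
  injOn : ∀ i, InjOn (φ i) T.support
  disjoint : ∀ {i j u v u' v'}, T.Adj u v → T.Adj u' v' → φ i u = φ j u' → φ i v = φ j v' → i = j
  cover : ∀ {x y}, G.Adj x y → ∃ i u v, T.Adj u v ∧ φ i u = x ∧ φ i v = y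

/-- The copies `φ i` of the anchor set `A` of the tile `T` partition the anchor set `S`. -/
structure IsAnchored (T : SimpleGraph U) (A : Set U) (S : Set V) (φ : I → U → V) : Prop where
  subset_support : A ⊆ T.support
  bijOn : BijOn (fun p : I × U => φ p.1 p.2) (univ ×ˢ A) S

namespace IsTiling

variable {T : SimpleGraph U} {G : SimpleGraph V} {H : SimpleGraph W} {φ : I → U → V}

theorem mem_support (h : IsTiling T G φ) (i : I) {u : U} (hu : u ∈ T.support) :
    φ i u ∈ G.support := by
  obtain ⟨v, huv⟩ := hu
  exact ⟨φ i v, h.adj i huv⟩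

theorem trans {ψ : J → V → W} (hφ : IsTiling T G φ) (hψ : IsTiling G H ψ) :
    IsTiling T H (fun (k : J × I) u => ψ k.1 (φ k.2 u)) where
  adj k _ _ h := hψ.adj k.1 (hφ.adj k.2 h)
  injOn k u hu v hv h :=
    hφ.injOn k.2 hu hv (hψ.injOn k.1 (hφ.mem_support _ hu) (hφ.mem_support _ hv) h)
  disjoint := by
    rintro ⟨j, i⟩ ⟨j', i'⟩ u v u' v' huv huv' hu hv
    have e := hφ.adj i huv
    have e' := hφ.adj i' huv'
    obtain rfl : j = j' := hψ.disjoint e e' hu hv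
    exact Prod.ext rfl (hφ.disjoint huv huv'
      (hψ.injOn j e.mem_support_left e'.mem_support_left hu)
      (hψ.injOn j e.mem_support_right e'.mem_support_right hv))
  cover h := by
    obtain ⟨j, x, y, hxy, rfl, rfl⟩ := hψ.cover h
    obtain ⟨i, u, v, huv, rfl, rfl⟩ := hφ.cover hxy
    exact ⟨(j, i), u, v, huv, rfl, rfl⟩

theorem relabel {f : V → W} (adj : ∀ {x y}, G.Adj x y → H.Adj (f x) (f y))
    (injOn : InjOn f G.support)
    (cover : ∀ {x y}, H.Adj x y → ∃ u v, G.Adj u v ∧ f u = x ∧ f v = y) :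
    IsTiling G H (fun _ : Unit => f) where
  adj _ _ _ := adj
  injOn _ := injOn
  disjoint _ _ _ _ := rfl
  cover h := ⟨(), cover h⟩

theorem induce {D : Set V} (h : IsTiling T G φ) (hT : T.support = univ) (hD : G.support ⊆ D) :
    IsTiling T (G.induce D)
      (fun i u => ⟨φ i u, hD (h.mem_support i (hT ▸ mem_univ u))⟩) where
  adj i _ _ huv := h.adj i huv
  injOn i u hu v hv huv := h.injOn i hu hv (congrArg Subtype.val huv)
  disjoint huv huv' hu hv := h.disjoint huv huv' (congrArg Subtype.val hu) (congrArg Subtype.val hv)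
  cover hxy := by
    obtain ⟨i, u, v, huv, hx, hy⟩ := h.cover hxy
    exact ⟨i, u, v, huv, Subtype.ext hx, Subtype.ext hy⟩

end IsTiling

theorem IsAnchored.trans {T : SimpleGraph U} {G : SimpleGraph V} {A : Set U} {S : Set V} {R : Set W}
    {φ : I → U → V} {ψ : J → V → W} (hφ : IsAnchored T A S φ) (hψ : IsAnchored G S R ψ) :
    IsAnchored T A R (fun (k : J × I) u => ψ k.1 (φ k.2 u)) := by
  have maps : ∀ {i u}, u ∈ A → φ i u ∈ S := fun hu => hφ.bijOn.mapsTo (mk_mem_prod trivial hu)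
  refine ⟨hφ.subset_support, fun k hk => hψ.bijOn.mapsTo (mk_mem_prod trivial (maps hk.2)), ?_, ?_⟩
  · rintro ⟨⟨j, i⟩, u⟩ ⟨-, hu⟩ ⟨⟨j', i'⟩, u'⟩ ⟨-, hu'⟩ h
    obtain ⟨rfl, h'⟩ := Prod.ext_iff.1 (hψ.bijOn.injOn (mk_mem_prod trivial (maps hu))
      (mk_mem_prod trivial (maps hu')) h)
    obtain ⟨rfl, rfl⟩ := Prod.ext_iff.1 (hφ.bijOn.injOn (mk_mem_prod trivial hu)
      (mk_mem_prod trivial hu') h')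
    rfl
  · intro w hw
    obtain ⟨⟨j, v⟩, ⟨-, hv⟩, rfl⟩ := hψ.bijOn.surjOn hw
    obtain ⟨⟨i, u⟩, ⟨-, hu⟩, rfl⟩ := hφ.bijOn.surjOn hv
    exact ⟨((j, i), u), mk_mem_prod trivial hu, rfl⟩

/-- `G` is the edge-disjoint union of finitely many copies of `T`. In contrast to `Decomposes`, the
isolated vertices of `T` and `G` are disregarded. -/
def Tiles (T : SimpleGraph U) (G : SimpleGraph V) : Prop :=
  ∃ (I : Type) (_ : Finite I) (φ : I → U → V), IsTiling T G φ

/-- `G` is the edge-disjoint union of finitely many copies of `T`, such that the anchor set `S` is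
the disjoint union of the corresponding copies of `A`. -/
def AnchoredTiles (T : SimpleGraph U) (A : Set U) (G : SimpleGraph V) (S : Set V) : Prop :=
  ∃ (I : Type) (_ : Finite I) (φ : I → U → V), IsTiling T G φ ∧ IsAnchored T A S φ

variable {T : SimpleGraph U} {G : SimpleGraph V} {H : SimpleGraph W}
  {A : Set U} {S : Set V} {R : Set W}

theorem AnchoredTiles.tiles : AnchoredTiles T A G S → Tiles T G :=
  fun ⟨I, hI, φ, hφ, _⟩ => ⟨I, hI, φ, hφ⟩

theorem AnchoredTiles.subset_support : AnchoredTiles T A G S → S ⊆ G.support := by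
  rintro ⟨I, -, φ, hφ, aφ⟩ v hv
  obtain ⟨⟨i, u⟩, ⟨-, hu⟩, rfl⟩ := aφ.bijOn.surjOn hv
  exact hφ.mem_support i (aφ.subset_support hu)

theorem Tiles.trans : Tiles T G → Tiles G H → Tiles T H :=
  fun ⟨_, _, _, hφ⟩ ⟨_, _, _, hψ⟩ => ⟨_, inferInstance, _, hφ.trans hψ⟩

theorem AnchoredTiles.trans :
    AnchoredTiles T A G S → AnchoredTiles G S H R → AnchoredTiles T A H R :=
  fun ⟨_, _, _, hφ, aφ⟩ ⟨_, _, _, hψ, aψ⟩ => ⟨_, inferInstance, _, hφ.trans hψ, aφ.trans aψ⟩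

theorem AnchoredTiles.relabel {f : V → W} (hS : S ⊆ G.support)
    (adj : ∀ {x y}, G.Adj x y → H.Adj (f x) (f y)) (injOn : InjOn f G.support)
    (cover : ∀ {x y}, H.Adj x y → ∃ u v, G.Adj u v ∧ f u = x ∧ f v = y) (image : f '' S = R) :
    AnchoredTiles G S H R := by
  refine ⟨Unit, inferInstance, _, .relabel adj injOn cover, hS, fun p hp => ?_, ?_, ?_⟩
  · exact image ▸ mem_image_of_mem f hp.2
  · rintro ⟨_, u⟩ ⟨-, hu⟩ ⟨_, v⟩ ⟨-, hv⟩ h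
    exact Prod.ext rfl (injOn (hS hu) (hS hv) h)
  · rintro w hw
    obtain ⟨v, hv, rfl⟩ := image ▸ hw
    exact ⟨((), v), mk_mem_prod trivial hv, rfl⟩

theorem Tiles.decomposes {U V : Type} [Nonempty V] {T : SimpleGraph U} {G : SimpleGraph V}
    (h : Tiles T G) (hT : T.support = univ) (hG : G.support = univ) : Decomposes T G := by
  obtain ⟨I, _, φ, hφ⟩ := h
  obtain ⟨n, ⟨e⟩⟩ := Finite.exists_equiv_fin I
  let copy (i : I) : Copy T G := ⟨⟨φ i, hφ.adj i⟩, injOn_univ.1 (hT ▸ hφ.injOn i)⟩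
  have exists_copy {x y} (hxy : G.Adj x y) : ∃ r, (copy (e.symm r)).toSubgraph.Adj x y := by
    obtain ⟨i, u, v, huv, hx, hy⟩ := hφ.cover hxy
    exact ⟨e i, by simpa only [e.symm_apply_apply] using ⟨u, v, huv, hx, hy⟩⟩
  have exists_adj (x : V) : ∃ y, G.Adj x y := (G.mem_support).1 (hG ▸ mem_univ x)
  refine ⟨n, fun r => (copy (e.symm r)).toSubgraph, ?_, fun r => ⟨(copy _).isoToSubgraph⟩,
    fun r s hrs => ?_, ?_⟩
  · obtain ⟨y, hxy⟩ := exists_adj (Classical.arbitrary V)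
    exact (exists_copy hxy).choose.pos
  · rw [Set.disjoint_left]
    refine Sym2.ind fun x y => ?_
    rintro ⟨u, v, huv, rfl, rfl⟩ ⟨u', v', huv', hu, hv⟩
    exact hrs (e.symm.injective (hφ.disjoint huv huv' hu.symm hv.symm))
  · refine Subgraph.ext (eq_univ_of_forall fun x => ?_) (funext₂ fun x y => propext ?_)
    · obtain ⟨y, hxy⟩ := exists_adj x
      exact (Subgraph.iSup_adj.2 (exists_copy hxy)).fst_mem
    · exact ⟨fun h => h.adj_sub, fun h => Subgraph.iSup_adj.2 (exists_copy h)⟩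

end Tilings

section AnchoredBox

variable {V W V' W' : Type*}

/-- The anchored product of two graphs on all pairs of vertices. The pairs without a coordinate in
the respective anchor set, which `anchoredProd₂` leaves out, are isolated. -/
def anchoredBox (G : SimpleGraph V) (S : Set V) (H : SimpleGraph W) (R : Set W) :
    SimpleGraph (V × W) where
  Adj p q := (G.Adj p.1 q.1 ∧ p.2 = q.2 ∧ p.2 ∈ R) ∨ (H.Adj p.2 q.2 ∧ p.1 = q.1 ∧ p.1 ∈ S)
  symm := ⟨by
    rintro p q (⟨h, e, m⟩ | ⟨h, e, m⟩)
    · exact Or.inl ⟨h.symm, e.symm, e ▸ m⟩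
    · exact Or.inr ⟨h.symm, e.symm, e ▸ m⟩⟩
  loopless := ⟨by
    rintro p (⟨h, -, -⟩ | ⟨h, -, -⟩) <;> exact h.ne rfl⟩

variable {G : SimpleGraph V} {S : Set V} {H : SimpleGraph W} {R : Set W}
  {G' : SimpleGraph V'} {S' : Set V'} {H' : SimpleGraph W'} {R' : Set W'}

theorem prod_subset_support_anchoredBox (hS : S ⊆ G.support) :
    S ×ˢ R ⊆ (anchoredBox G S H R).support := by
  rintro ⟨v, w⟩ ⟨hv, hw⟩
  obtain ⟨v', hvv'⟩ := hS hv
  exact ⟨(v', w), Or.inl ⟨hvv', rfl, hw⟩⟩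

theorem support_anchoredBox_subset (hS : S ⊆ G.support) (hR : R ⊆ H.support) :
    (anchoredBox G S H R).support ⊆ G.support ×ˢ H.support := by
  rintro ⟨v, w⟩ ⟨⟨v', w'⟩, ⟨h, -, hw⟩ | ⟨h, -, hv⟩⟩
  · exact ⟨h.mem_support_left, hR hw⟩
  · exact ⟨hS hv, h.mem_support_left⟩

variable {I J : Type*} {φ : I → V → V'} {ψ : J → W → W'}

theorem IsTiling.box (hφ : IsTiling G G' φ) (aφ : IsAnchored G S S' φ) (hψ : IsTiling H H' ψ)
    (aψ : IsAnchored H R R' ψ) :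
    IsTiling (anchoredBox G S H R) (anchoredBox G' S' H' R')
      (fun (k : I × J) => Prod.map (φ k.1) (ψ k.2)) where
  adj := by
    rintro ⟨i, j⟩ ⟨v, w⟩ ⟨v', w'⟩ (⟨h, e, m⟩ | ⟨h, e, m⟩)
    · exact Or.inl ⟨hφ.adj i h, congrArg (ψ j) e, aψ.bijOn.mapsTo (mk_mem_prod (mem_univ j) m)⟩
    · exact Or.inr ⟨hψ.adj j h, congrArg (φ i) e, aφ.bijOn.mapsTo (mk_mem_prod (mem_univ i) m)⟩
  injOn k p hp q hq h := by
    have sub := support_anchoredBox_subset aφ.subset_support aψ.subset_support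
    obtain ⟨h₁, h₂⟩ := Prod.ext_iff.1 h
    exact Prod.ext (hφ.injOn k.1 (sub hp).1 (sub hq).1 h₁) (hψ.injOn k.2 (sub hp).2 (sub hq).2 h₂)
  disjoint := by
    rintro ⟨i, j⟩ ⟨i', j'⟩ ⟨x, y⟩ ⟨x₁, y₁⟩ ⟨x', y'⟩ ⟨x₁', y₁'⟩ e e' hu hv
    simp only [Prod.map, Prod.mk.injEq] at hu hv
    rcases e with ⟨e, rfl, m⟩ | ⟨e, rfl, m⟩ <;> rcases e' with ⟨e', rfl, m'⟩ | ⟨e', rfl, m'⟩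
    · obtain ⟨rfl, -⟩ := Prod.ext_iff.1 (aψ.bijOn.injOn (mk_mem_prod (mem_univ j) m)
        (mk_mem_prod (mem_univ j') m') hu.2)
      exact Prod.ext (hφ.disjoint e e' hu.1 hv.1) rfl
    · exact ((hφ.adj i e).ne (hu.1.trans hv.1.symm)).elim
    · exact ((hφ.adj i' e').ne (hu.1.symm.trans hv.1)).elim
    · obtain ⟨rfl, -⟩ := Prod.ext_iff.1 (aφ.bijOn.injOn (mk_mem_prod (mem_univ i) m)
        (mk_mem_prod (mem_univ i') m') hu.1)
      exact Prod.ext rfl (hψ.disjoint e e' hu.2 hv.2)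
  cover := by
    rintro ⟨x, y⟩ ⟨x', y'⟩ (⟨h, rfl, m⟩ | ⟨h, rfl, m⟩)
    · obtain ⟨i, v, v', hv, rfl, rfl⟩ := hφ.cover h
      obtain ⟨⟨j, w⟩, ⟨-, hw⟩, rfl⟩ := aψ.bijOn.surjOn m
      exact ⟨(i, j), (v, w), (v', w), Or.inl ⟨hv, rfl, hw⟩, rfl, rfl⟩
    · obtain ⟨j, w, w', hw, rfl, rfl⟩ := hψ.cover h
      obtain ⟨⟨i, v⟩, ⟨-, hv⟩, rfl⟩ := aφ.bijOn.surjOn m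
      exact ⟨(i, j), (v, w), (v, w'), Or.inr ⟨hw, rfl, hv⟩, rfl, rfl⟩

theorem IsAnchored.box (aφ : IsAnchored G S S' φ) (aψ : IsAnchored H R R' ψ) :
    IsAnchored (anchoredBox G S H R) (S ×ˢ R) (S' ×ˢ R')
      (fun (k : I × J) => Prod.map (φ k.1) (ψ k.2)) := by
  refine ⟨prod_subset_support_anchoredBox aφ.subset_support, ?_, ?_, ?_⟩
  · rintro ⟨⟨i, j⟩, v, w⟩ ⟨-, hv, hw⟩
    exact ⟨aφ.bijOn.mapsTo (mk_mem_prod (mem_univ i) hv),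
      aψ.bijOn.mapsTo (mk_mem_prod (mem_univ j) hw)⟩
  · rintro ⟨⟨i, j⟩, v, w⟩ ⟨-, hv, hw⟩ ⟨⟨i', j'⟩, v', w'⟩ ⟨-, hv', hw'⟩ h
    obtain ⟨h₁, h₂⟩ := Prod.ext_iff.1 h
    obtain ⟨rfl, rfl⟩ := Prod.ext_iff.1 (aφ.bijOn.injOn (mk_mem_prod (mem_univ i) hv)
      (mk_mem_prod (mem_univ i') hv') h₁)
    obtain ⟨rfl, rfl⟩ := Prod.ext_iff.1 (aψ.bijOn.injOn (mk_mem_prod (mem_univ j) hw)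
      (mk_mem_prod (mem_univ j') hw') h₂)
    rfl
  · rintro ⟨x, y⟩ ⟨hx, hy⟩
    obtain ⟨⟨i, v⟩, ⟨-, hv⟩, rfl⟩ := aφ.bijOn.surjOn hx
    obtain ⟨⟨j, w⟩, ⟨-, hw⟩, rfl⟩ := aψ.bijOn.surjOn hy
    exact ⟨((i, j), (v, w)), mk_mem_prod trivial (mk_mem_prod hv hw), rfl⟩

theorem AnchoredTiles.box : AnchoredTiles G S G' S' → AnchoredTiles H R H' R' →
    AnchoredTiles (anchoredBox G S H R) (S ×ˢ R) (anchoredBox G' S' H' R') (S' ×ˢ R') :=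
  fun ⟨_, _, _, hφ, aφ⟩ ⟨_, _, _, hψ, aψ⟩ =>
    ⟨_, inferInstance, _, hφ.box aφ hψ aψ, aφ.box aψ⟩

end AnchoredBox

section AnchoredPi

variable {ι : Type*} {V : ι → Type*} {G : ∀ j, SimpleGraph (V j)} {S : ∀ j, Set (V j)}

/-- The anchored product of a family of graphs on all tuples of vertices. The tuples with more than
one coordinate outside the anchor sets, which `anchoredProd` leaves out, are isolated. -/
def anchoredPi (G : ∀ j, SimpleGraph (V j)) (S : ∀ j, Set (V j)) : SimpleGraph (∀ j, V j) where
  Adj u v := ∃ j, (G j).Adj (u j) (v j) ∧ ∀ k, k ≠ j → u k = v k ∧ u k ∈ S k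
  symm := ⟨by
    rintro u v ⟨j, h, H⟩
    exact ⟨j, h.symm, fun k hk => ⟨(H k hk).1.symm, (H k hk).1 ▸ (H k hk).2⟩⟩⟩
  loopless := ⟨by
    rintro u ⟨j, h, -⟩
    exact h.ne rfl⟩

theorem support_anchoredPi_subset : (anchoredPi G S).support ⊆
    {v : ∀ j, V j | ∀ j k, j ≠ k → v j ∈ S j ∨ v k ∈ S k} := by
  rintro u ⟨v, i, -, h⟩ j k hjk
  by_cases hi : j = i
  · exact Or.inr (h k fun e => hjk (hi.trans e.symm)).2
  · exact Or.inl (h j hi).2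

theorem anchoredProd_support {ι : Type} [Nonempty ι] {V : ι → Type} {G : ∀ j, SimpleGraph (V j)}
    {S : ∀ j, Set (V j)} (hG : ∀ j, (G j).support = univ) : (anchoredProd G S).support = univ := by
  classical
  refine eq_univ_of_forall fun v => ?_
  obtain ⟨j, hj⟩ : ∃ j, ∀ k, k ≠ j → v.1 k ∈ S k := by
    by_cases! h : ∃ j, v.1 j ∉ S j
    · obtain ⟨j, hj⟩ := h
      exact ⟨j, fun k hk => (v.2 k j hk).resolve_right hj⟩
    · exact ⟨Classical.arbitrary ι, fun k _ => h k⟩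
  obtain ⟨w, hw⟩ : v.1 j ∈ (G j).support := hG j ▸ mem_univ _
  have hmem : ∀ k, k ≠ j → Function.update v.1 j w k ∈ S k := fun k hk =>
    (Function.update_of_ne hk w v.1).symm ▸ hj k hk
  refine ⟨⟨Function.update v.1 j w, fun k l hkl => ?_⟩, j, by simpa using hw,
    fun k hk => ⟨(Function.update_of_ne hk _ _).symm, hj k hk⟩⟩
  by_cases hk : k = j
  · exact Or.inr (hmem l fun hl => hkl (hk.trans hl.symm))
  · exact Or.inl (hmem k hk)

theorem anchoredProd_eq_induce {ι : Type} {V : ι → Type} (G : ∀ j, SimpleGraph (V j))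
    (S : ∀ j, Set (V j)) : anchoredProd G S =
      (anchoredPi G S).induce {v : ∀ j, V j | ∀ j k, j ≠ k → v j ∈ S j ∨ v k ∈ S k} := rfl

theorem tiles_anchoredProd {U : Type*} {ι : Type} {V : ι → Type} {G : ∀ j, SimpleGraph (V j)}
    {S : ∀ j, Set (V j)} {T : SimpleGraph U} (h : Tiles T (anchoredPi G S))
    (hT : T.support = univ) : Tiles T (anchoredProd G S) := by
  obtain ⟨I, hI, φ, hφ⟩ := h
  rw [anchoredProd_eq_induce]
  exact ⟨I, hI, _, hφ.induce hT support_anchoredPi_subset⟩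

theorem fst_apply_of_mem_support {j : ι} {x : V j} {H : SimpleGraph (V j)}
    {R : Set (V j)} (hG : G j = ⊥) (hS : S j = {x}) {p : (∀ j, V j) × V j}
    (hp : p ∈ (anchoredBox (anchoredPi G S) (univ.pi S) H R).support) : p.1 j = x := by
  suffices p.1 j ∈ S j by rwa [hS] at this
  obtain ⟨q, ⟨⟨i, hi, h⟩, -, -⟩ | ⟨-, -, h⟩⟩ := hp
  · exact (h j (by rintro rfl; simp [hG] at hi)).2
  · exact h j trivial

section Update

variable [DecidableEq ι] {j : ι} {x : V j} {H : SimpleGraph (V j)} {R : Set (V j)}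

theorem anchoredPi_update_adj (hG : G j = ⊥) {p q : (∀ j, V j) × V j}
    (h : (anchoredBox (anchoredPi G S) (univ.pi S) H R).Adj p q) :
    (anchoredPi (Function.update G j H) (Function.update S j R)).Adj
      (Function.update p.1 j p.2) (Function.update q.1 j q.2) := by
  rcases h with ⟨⟨i, hi, h⟩, e, m⟩ | ⟨h, e, m⟩
  · have hij : i ≠ j := by rintro rfl; simp [hG] at hi
    refine ⟨i, by simpa [hij] using hi, fun k hk => ?_⟩
    by_cases hkj : k = j
    · subst hkj
      simpa using ⟨e, m⟩
    · simpa [hkj] using h k hk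
  · refine ⟨j, by simpa using h, fun k hk => ?_⟩
    simpa [hk] using ⟨congrFun e k, m k trivial⟩

theorem exists_adj_of_anchoredPi_update_adj (hS : S j = {x}) {u v : ∀ j, V j}
    (h : (anchoredPi (Function.update G j H) (Function.update S j R)).Adj u v) :
    ∃ p q, (anchoredBox (anchoredPi G S) (univ.pi S) H R).Adj p q ∧
      Function.update p.1 j p.2 = u ∧ Function.update q.1 j q.2 = v := by
  refine ⟨(Function.update u j x, u j), (Function.update v j x, v j), ?_, by simp, by simp⟩
  obtain ⟨i, hi, h⟩ := h
  by_cases hij : i = j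
  · subst hij
    refine Or.inr ⟨by simpa using hi, funext fun k => ?_, fun k _ => ?_⟩ <;>
      by_cases hk : k = i
    · subst hk; simp
    · simpa [hk] using (h k hk).1
    · subst hk; simp [hS]
    · simpa [hk] using (h k hk).2
  · have hj := h j (Ne.symm hij)
    refine Or.inl ⟨⟨i, by simpa [hij] using hi, fun k hk => ?_⟩, by simpa using hj⟩
    by_cases hkj : k = j
    · subst hkj; simp [hS]
    · simpa [hkj] using h k hk

theorem image_update_pi (hS : S j = {x}) :
    (fun p : (∀ j, V j) × V j => Function.update p.1 j p.2) '' (univ.pi S ×ˢ R) =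
      univ.pi (Function.update S j R) := by
  ext u
  constructor
  · rintro ⟨⟨v, y⟩, ⟨hv, hy⟩, rfl⟩ k -
    by_cases hk : k = j
    · subst hk; simpa using hy
    · simpa [hk] using hv k trivial
  · intro hu
    refine ⟨(Function.update u j x, u j), ⟨fun k _ => ?_, by simpa using hu j trivial⟩, by simp⟩
    by_cases hk : k = j
    · subst hk; simp [hS]
    · simpa [hk] using hu k trivial

theorem anchoredTiles_anchoredPi_update (hG : G j = ⊥) (hS : S j = {x}) (hR : R ⊆ H.support) :
    AnchoredTiles (anchoredBox (anchoredPi G S) (univ.pi S) H R) (univ.pi S ×ˢ R)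
      (anchoredPi (Function.update G j H) (Function.update S j R))
      (univ.pi (Function.update S j R)) := by
  refine .relabel ?_ (anchoredPi_update_adj hG) ?_ (exists_adj_of_anchoredPi_update_adj hS)
    (image_update_pi hS)
  · rintro ⟨u, y⟩ ⟨hu, hy⟩
    obtain ⟨y', hyy'⟩ := hR hy
    exact ⟨(u, y'), Or.inr ⟨hyy', rfl, hu⟩⟩
  · rintro ⟨u, y⟩ hu ⟨v, z⟩ hv h
    refine Prod.ext (funext fun k => ?_) (by simpa using congrFun h j)
    by_cases hk : k = j
    · subst hk
      exact (fst_apply_of_mem_support hG hS hu).trans (fst_apply_of_mem_support hG hS hv).symm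
    · simpa [hk] using congrFun h k

end Update

end AnchoredPi

theorem anchoredTiles_anchoredBox_singleton {V W : Type*} {H : SimpleGraph W} {R : Set W}
    (hR : R ⊆ H.support) (v : V) : AnchoredTiles H R (anchoredBox ⊥ {v} H R) ({v} ×ˢ R) := by
  refine .relabel (f := Prod.mk v) hR (fun h => Or.inr ⟨h, rfl, rfl⟩)
    (Prod.mk_right_injective v).injOn ?_ singleton_prod.symm
  rintro ⟨_, w⟩ ⟨_, w'⟩ (⟨h, -, -⟩ | ⟨h, rfl, rfl⟩)
  · exact h.elim
  · exact ⟨w, w', h, rfl, rfl⟩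

section PartialProduct

variable {ι : Type*} [DecidableEq ι] {V : ι → Type*}

/-- The factors in `s` of a family of graphs; the other factors have no edges. -/
def partialFactors (G : ∀ j, SimpleGraph (V j)) (s : Finset ι) : ∀ j, SimpleGraph (V j) :=
  s.piecewise G ⊥

/-- The anchor sets in the coordinates in `s`; the other coordinates are anchored to those of the
base point `o`. -/
def partialAnchors (S : ∀ j, Set (V j)) (o : ∀ j, V j) (s : Finset ι) : ∀ j, Set (V j) :=
  s.piecewise S fun j => {o j}

/-- The anchored product of the factors in `s`, with the other coordinates fixed to those of the
base point `o`. -/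
def partialProd (G : ∀ j, SimpleGraph (V j)) (S : ∀ j, Set (V j)) (o : ∀ j, V j) (s : Finset ι) :
    SimpleGraph (∀ j, V j) :=
  anchoredPi (partialFactors G s) (partialAnchors S o s)

variable {G : ∀ j, SimpleGraph (V j)} {S : ∀ j, Set (V j)} {o : ∀ j, V j} {s : Finset ι} {j : ι}

theorem partialProd_univ [Fintype ι] : partialProd G S o Finset.univ = anchoredPi G S := by
  simp only [partialProd, partialFactors, partialAnchors, Finset.piecewise_univ]

theorem anchoredTiles_partialProd_insert (hj : j ∉ s) (hS : S j ⊆ (G j).support) :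
    AnchoredTiles (anchoredBox (partialProd G S o s) (univ.pi (partialAnchors S o s)) (G j) (S j))
      (univ.pi (partialAnchors S o s) ×ˢ S j)
      (partialProd G S o (insert j s)) (univ.pi (partialAnchors S o (insert j s))) := by
  simp only [partialProd, partialFactors, partialAnchors, Finset.piecewise_insert]
  exact anchoredTiles_anchoredPi_update (x := o j) (Finset.piecewise_eq_of_notMem _ _ _ hj)
    (Finset.piecewise_eq_of_notMem _ _ _ hj) hS

theorem anchoredTiles_partialProd_singleton (hS : S j ⊆ (G j).support) :
    AnchoredTiles (G j) (S j) (partialProd G S o {j}) (univ.pi (partialAnchors S o {j})) := by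
  have bot : partialProd G S o ∅ = ⊥ := by
    ext u v
    simp [partialProd, partialFactors, anchoredPi]
  have base : univ.pi (partialAnchors S o ∅) = {o} := by
    simp only [partialAnchors, Finset.piecewise_empty, univ_pi_singleton]
  have h := anchoredTiles_partialProd_insert (o := o) (Finset.notMem_empty j) hS
  rw [bot, base] at h
  exact (anchoredTiles_anchoredBox_singleton hS o).trans h

end PartialProduct

section Cycles

/-- The cycle on the residues modulo `ℓ`. -/
abbrev zmodCycle (ℓ : ℕ) : SimpleGraph (ZMod ℓ) := circulantGraph {1}

/-- The residues modulo `ℓ` whose least nonnegative representative is divisible by `m`. -/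
def multiples (ℓ m : ℕ) : Set (ZMod ℓ) := {t | m ∣ t.val}

theorem zmodCycle_adj {ℓ : ℕ} (hℓ : 2 ≤ ℓ) {x y : ZMod ℓ} :
    (zmodCycle ℓ).Adj x y ↔ y = x + 1 ∨ x = y + 1 := by
  have : Fact (1 < ℓ) := ⟨hℓ⟩
  simp only [circulantGraph, fromRel_adj, mem_singleton_iff, sub_eq_iff_eq_add']
  constructor
  · rintro ⟨-, h | h⟩
    · exact Or.inr h
    · exact Or.inl h
  · rintro (rfl | rfl) <;> simp

theorem zmodCycle_adj_add_one {ℓ : ℕ} (hℓ : 2 ≤ ℓ) (x : ZMod ℓ) : (zmodCycle ℓ).Adj x (x + 1) :=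
  (zmodCycle_adj hℓ).2 (Or.inl rfl)

theorem support_zmodCycle {ℓ : ℕ} (hℓ : 2 ≤ ℓ) : (zmodCycle ℓ).support = univ :=
  eq_univ_of_forall fun x => ⟨x + 1, zmodCycle_adj_add_one hℓ x⟩

theorem IsTiling.zmodCycle {K V : Type*} {G : SimpleGraph V} {ℓ : ℕ} {c : K → ZMod ℓ → V}
    (hℓ : 2 ≤ ℓ) (adj : ∀ k t, G.Adj (c k t) (c k (t + 1))) (inj : ∀ k, Function.Injective (c k))
    (disjoint : ∀ {k t k' t'}, s(c k t, c k (t + 1)) = s(c k' t', c k' (t' + 1)) → k = k')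
    (cover : ∀ {x y}, G.Adj x y → ∃ k t, s(c k t, c k (t + 1)) = s(x, y)) :
    IsTiling (zmodCycle ℓ) G c where
  adj k t t' h := by
    rcases (zmodCycle_adj hℓ).1 h with rfl | rfl
    · exact adj k t
    · exact (adj k t').symm
  injOn k := (inj k).injOn
  disjoint h h' hu hv := by
    rcases (zmodCycle_adj hℓ).1 h with rfl | rfl <;> rcases (zmodCycle_adj hℓ).1 h' with rfl | rfl
    · exact disjoint (Sym2.eq_iff.2 (Or.inl ⟨hu, hv⟩))
    · exact disjoint (Sym2.eq_iff.2 (Or.inr ⟨hu, hv⟩))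
    · exact disjoint (Sym2.eq_iff.2 (Or.inr ⟨hv, hu⟩))
    · exact disjoint (Sym2.eq_iff.2 (Or.inl ⟨hv, hu⟩))
  cover h := by
    obtain ⟨k, t, hkt⟩ := cover h
    rcases Sym2.eq_iff.1 hkt with ⟨rfl, rfl⟩ | ⟨rfl, rfl⟩
    · exact ⟨k, t, t + 1, zmodCycle_adj_add_one hℓ t, rfl, rfl⟩
    · exact ⟨k, t + 1, t, (zmodCycle_adj_add_one hℓ t).symm, rfl, rfl⟩

/-- `G` decomposes into cycles with `n` anchors each, at distance `m` along the cycle. -/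
abbrev AnchoredCycles (n m : ℕ) {V : Type*} (G : SimpleGraph V) (S : Set V) : Prop :=
  AnchoredTiles (zmodCycle (n * m)) (multiples (n * m) m) G S

theorem cycleGraph_eq_zmodCycle (n : ℕ) : cycleGraph (n + 1) = zmodCycle (n + 1) :=
  cycleGraph_eq_circulantGraph n

theorem support_cycleGraph {n : ℕ} (hn : 2 ≤ n) : (cycleGraph n).support = univ := by
  obtain ⟨n, rfl⟩ := Nat.exists_eq_add_of_le' hn
  exact (congrArg support (cycleGraph_eq_zmodCycle (n + 1))).trans (support_zmodCycle hn)

theorem tiles_cycleGraph_iff {V : Type*} {G : SimpleGraph V} {n : ℕ} (hn : 1 ≤ n) :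
    Tiles (cycleGraph n) G ↔ Tiles (zmodCycle n) G := by
  obtain ⟨n, rfl⟩ := Nat.exists_eq_add_of_le' hn
  exact iff_of_eq (congrArg (Tiles · G) (cycleGraph_eq_zmodCycle n))

theorem anchoredTiles_cycleGraph {n : ℕ} (hn : 2 ≤ n) (m : ℕ) :
    AnchoredTiles (zmodCycle n) (multiples n m) (cycleGraph n) (everyNth n m) := by
  obtain ⟨n, rfl⟩ := Nat.exists_eq_add_of_le' hn
  refine .relabel (f := id) (support_zmodCycle hn ▸ subset_univ _) (fun h => ?_) (injOn_id _)
    (fun {x y} h => ⟨x, y, ?_, rfl, rfl⟩) (image_id _)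
  · exact (cycleGraph_eq_zmodCycle (n + 1)).symm ▸ h
  · exact cycleGraph_eq_zmodCycle (n + 1) ▸ h

/-- The toroidal `p × q` grid whose horizontal edges are subdivided into `a` edges each and whose
vertical edges are subdivided into `b` edges each. -/
abbrev subdividedTorus (p q a b : ℕ) : SimpleGraph (ZMod (p * a) × ZMod (q * b)) :=
  anchoredBox (zmodCycle (p * a)) (multiples (p * a) a) (zmodCycle (q * b)) (multiples (q * b) b)

/-- The vertices of the toroidal grid in its subdivision. -/
abbrev gridVertices (p q a b : ℕ) : Set (ZMod (p * a) × ZMod (q * b)) :=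
  multiples (p * a) a ×ˢ multiples (q * b) b

end Cycles

/-- The four directions of travel in the grid `ℤ × ℤ`. -/
inductive Heading
  | east
  | west
  | north
  | south
deriving DecidableEq

namespace Heading

/-- The change of the first coordinate in one step in the direction `θ`. -/
def dx : Heading → ℤ
  | east => 1
  | west => -1
  | north | south => 0

/-- The change of the second coordinate in one step in the direction `θ`. -/
def dy : Heading → ℤ
  | east | west => 0
  | north => 1
  | south => -1

/-- The length of a grid edge in the direction `θ`, where horizontal edges have length `a` and
vertical edges have length `b`. -/
def weight (a b : ℕ) : Heading → ℕ
  | east | west => a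
  | north | south => b

/-- The direction `θ` is east or west. -/
def Horizontal (θ : Heading) : Prop := θ = east ∨ θ = west

variable {a b : ℕ}

theorem weight_pos (ha : 0 < a) (hb : 0 < b) (θ : Heading) : 0 < θ.weight a b := by
  cases θ <;> assumption

theorem weight_mul_dx (θ : Heading) : (θ.weight a b : ℤ) * θ.dx = a * θ.dx := by
  cases θ <;> simp [weight, dx]

theorem weight_mul_dy (θ : Heading) : (θ.weight a b : ℤ) * θ.dy = b * θ.dy := by
  cases θ <;> simp [weight, dy]

theorem weight_eq (θ : Heading) : θ.weight a b = θ.weight 1 0 * a + θ.weight 0 1 * b := by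
  cases θ <;> simp [weight]

end Heading

open Heading

section Runs

variable {d : ℤ → ℤ → Heading} {x y x' y' x'' y'' : ℤ} {h v h' v' : ℕ}

/-- Following the direction field `d` from `(x, y)` leads to `(x', y')` after `h` horizontal and `v`
vertical steps. -/
inductive Run (d : ℤ → ℤ → Heading) (x y : ℤ) : ℕ → ℕ → ℤ → ℤ → Prop
  | refl : Run d x y 0 0 x y
  | step {h v x' y' θ} : Run d x y h v x' y' → d x' y' = θ →
      Run d x y (h + θ.weight 1 0) (v + θ.weight 0 1) (x' + θ.dx) (y' + θ.dy)

namespace Run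

theorem east (H : Run d x y h v x' y') (e : d x' y' = .east) : Run d x y (h + 1) v (x' + 1) y' := by
  simpa only [weight, dx, dy, add_zero] using H.step e

theorem west (H : Run d x y h v x' y') (e : d x' y' = .west) : Run d x y (h + 1) v (x' - 1) y' := by
  simpa only [weight, dx, dy, add_zero, ← sub_eq_add_neg] using H.step e

theorem north (H : Run d x y h v x' y') (e : d x' y' = .north) :
    Run d x y h (v + 1) x' (y' + 1) := by
  simpa only [weight, dx, dy, add_zero] using H.step e

theorem south (H : Run d x y h v x' y') (e : d x' y' = .south) :
    Run d x y h (v + 1) x' (y' - 1) := by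
  simpa only [weight, dx, dy, add_zero, ← sub_eq_add_neg] using H.step e

theorem trans (H : Run d x y h v x' y') (H' : Run d x' y' h' v' x'' y'') :
    Run d x y (h + h') (v + v') x'' y'' := by
  induction H' with
  | refl => exact H
  | step _ e ih => simpa only [add_assoc] using ih.step e

theorem map {d' : ℤ → ℤ → Heading} {f g : ℤ → ℤ} {ρ : Heading → Heading}
    (hρ : ∀ a b θ, (ρ θ).weight a b = θ.weight a b) (hf : ∀ x θ, f (x + dx θ) = f x + (ρ θ).dx)
    (hg : ∀ y θ, g (y + dy θ) = g y + (ρ θ).dy) (hd : ∀ x y, d' (f x) (g y) = ρ (d x y))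
    (H : Run d x y h v x' y') : Run d' (f x) (g y) h v (f x') (g y') := by
  induction H with
  | refl => exact .refl
  | step _ e ih =>
    rw [hf, hg, ← hρ 1 0, ← hρ 0 1]
    exact ih.step ((hd _ _).trans (congrArg ρ e))

theorem translate {s t : ℤ} (hd : ∀ x y, d (x + s) (y + t) = d x y) (H : Run d x y h v x' y') :
    Run d (x + s) (y + t) h v (x' + s) (y' + t) :=
  H.map (ρ := id) (fun _ _ _ => rfl) (fun _ _ => add_right_comm _ _ _)
    (fun _ _ => add_right_comm _ _ _) hd

end Run

/-- Following the direction field never leads back and forth along an edge. -/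
structure Unopposed (d : ℤ → ℤ → Heading) : Prop where
  east : ∀ {x y}, d x y = .east → d (x + 1) y ≠ .west
  north : ∀ {x y}, d x y = .north → d x (y + 1) ≠ .south

/-- The direction field that follows `d` on the grid whose horizontal edges are subdivided into `a`
edges each and whose vertical edges are subdivided into `b` edges each. The direction at an inner
vertex of an edge is read off from its left or lower end, where `d` leads into the edge or the edge
is traversed from the other end. -/
def subdivide (a b : ℕ) (d : ℤ → ℤ → Heading) (x y : ℤ) : Heading :=
  if ¬(a : ℤ) ∣ x then (if d (x / a) (y / b) = .east then .east else .west)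
  else if ¬(b : ℤ) ∣ y then (if d (x / a) (y / b) = .north then .north else .south)
  else d (x / a) (y / b)

/-- One step along the direction field `d`. -/
def fieldStep (d : ℤ → ℤ → Heading) (z : ℤ × ℤ) : ℤ × ℤ :=
  (z.1 + (d z.1 z.2).dx, z.2 + (d z.1 z.2).dy)

/-- The point at distance `u` from the grid vertex `(x, y)` on the subdivided edge along which the
direction field `d` leaves it. -/
def edgePoint (a b : ℕ) (d : ℤ → ℤ → Heading) (x y : ℤ) (u : ℕ) : ℤ × ℤ :=
  (a * x + u * (d x y).dx, b * y + u * (d x y).dy)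

variable {a b u : ℕ}

theorem subdivide_grid (ha : 0 < a) (hb : 0 < b) (x y : ℤ) :
    subdivide a b d (a * x) (b * y) = d x y := by
  rw [subdivide, if_neg (not_not.2 (dvd_mul_right _ _)), if_neg (not_not.2 (dvd_mul_right _ _)),
    Int.mul_ediv_cancel_left x (by omega), Int.mul_ediv_cancel_left y (by omega)]

theorem not_dvd_mul_add {w : ℤ} (h₀ : 0 < w) (h₁ : w < a) (x : ℤ) : ¬(a : ℤ) ∣ a * x + w := by
  rw [dvd_add_right (dvd_mul_right _ _)]
  exact fun h => (Int.le_of_dvd h₀ h).not_gt h₁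

theorem mul_add_ediv {w : ℤ} (h₀ : 0 ≤ w) (h₁ : w < a) (x : ℤ) : (a * x + w) / a = x := by
  rw [Int.mul_add_ediv_left _ _ (by omega), Int.ediv_eq_zero_of_lt h₀ h₁, add_zero]

theorem subdivide_horizontal {w : ℤ} (h₀ : 0 < w) (h₁ : w < a) (hb : 0 < b) (x y : ℤ) :
    subdivide a b d (a * x + w) (b * y) = if d x y = .east then .east else .west := by
  rw [subdivide, if_pos (not_dvd_mul_add h₀ h₁ x), mul_add_ediv h₀.le h₁,
    Int.mul_ediv_cancel_left y (by omega)]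

theorem subdivide_vertical {w : ℤ} (h₀ : 0 < w) (h₁ : w < b) (ha : 0 < a) (x y : ℤ) :
    subdivide a b d (a * x) (b * y + w) = if d x y = .north then .north else .south := by
  rw [subdivide, if_neg (not_not.2 (dvd_mul_right _ _)), if_pos (not_dvd_mul_add h₀ h₁ y),
    mul_add_ediv h₀.le h₁, Int.mul_ediv_cancel_left x (by omega)]

theorem Unopposed.subdivide_edgePoint (hd : Unopposed d) (ha : 0 < a) (hb : 0 < b)
    (hu : u < (d x y).weight a b) :
    subdivide a b d (edgePoint a b d x y u).1 (edgePoint a b d x y u).2 = d x y := by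
  rcases Nat.eq_zero_or_pos u with rfl | h₀
  · simpa [edgePoint] using subdivide_grid ha hb x y
  cases hθ : d x y <;>
    simp only [hθ, edgePoint, weight, dx, dy, mul_zero, add_zero, mul_one] at hu ⊢
  · rw [subdivide_horizontal (by omega) (by omega) hb, if_pos hθ]
  · have h : d (x - 1) y ≠ .east := fun h => hd.east h (by rwa [sub_add_cancel])
    rw [show (a * x + u * -1 : ℤ) = a * (x - 1) + (a - u) by ring,
      subdivide_horizontal (by omega) (by omega) hb, if_neg h]
  · rw [subdivide_vertical (by omega) (by omega) ha, if_pos hθ]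
  · have h : d x (y - 1) ≠ .north := fun h => hd.north h (by rwa [sub_add_cancel])
    rw [show (b * y + u * -1 : ℤ) = b * (y - 1) + (b - u) by ring,
      subdivide_vertical (by omega) (by omega) ha, if_neg h]

theorem edgePoint_zero : edgePoint a b d x y 0 = ((a * x : ℤ), (b * y : ℤ)) := by
  simp [edgePoint]

theorem edgePoint_weight : edgePoint a b d x y ((d x y).weight a b) =
    edgePoint a b d (x + (d x y).dx) (y + (d x y).dy) 0 := by
  rw [edgePoint, edgePoint_zero, weight_mul_dx, weight_mul_dy, mul_add, mul_add]

theorem Unopposed.fieldStep_edgePoint (hd : Unopposed d) (ha : 0 < a) (hb : 0 < b)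
    (hu : u < (d x y).weight a b) :
    fieldStep (subdivide a b d) (edgePoint a b d x y u) = edgePoint a b d x y (u + 1) := by
  rw [fieldStep, hd.subdivide_edgePoint ha hb hu, edgePoint, edgePoint]
  push_cast
  ring_nf

theorem Unopposed.iterate_edgePoint (hd : Unopposed d) (ha : 0 < a) (hb : 0 < b)
    (hu : u ≤ (d x y).weight a b) :
    (fieldStep (subdivide a b d))^[u] (edgePoint a b d x y 0) = edgePoint a b d x y u := by
  induction u with
  | zero => rfl
  | succ u ih => rw [Function.iterate_succ_apply', ih (by omega), hd.fieldStep_edgePoint ha hb hu]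

theorem Run.iterate (H : Run d x y h v x' y') (hd : Unopposed d) (ha : 0 < a) (hb : 0 < b) :
    (fieldStep (subdivide a b d))^[h * a + v * b] (edgePoint a b d x y 0) =
      edgePoint a b d x' y' 0 := by
  induction H with
  | refl => simp
  | @step h v x' y' _ _ e ih =>
    subst e
    rw [← edgePoint_weight, ← hd.iterate_edgePoint ha hb le_rfl, ← ih,
      ← Function.iterate_add_apply, weight_eq (a := a) (b := b)]
    congr 1
    ring

theorem Unopposed.exists_iterate_eq_edgePoint (hd : Unopposed d) (ha : 0 < a) (hb : 0 < b)
    (n : ℕ) : ∃ x' y' u, u < (d x' y').weight a b ∧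
      (fieldStep (subdivide a b d))^[n] (edgePoint a b d x y 0) = edgePoint a b d x' y' u := by
  induction n with
  | zero => exact ⟨x, y, 0, weight_pos ha hb _, rfl⟩
  | succ n ih =>
    obtain ⟨x', y', u, hu, e⟩ := ih
    rw [Function.iterate_succ_apply', e, hd.fieldStep_edgePoint ha hb hu]
    rcases (Nat.succ_le_of_lt hu).lt_or_eq with h | h
    · exact ⟨x', y', u + 1, h, rfl⟩
    · rw [← Nat.succ_eq_add_one, h, edgePoint_weight]
      exact ⟨_, _, 0, weight_pos ha hb _, rfl⟩

end Runs

section TorusFields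

variable {p q a b : ℕ} {d : ℤ → ℤ → Heading} {x y x' y' : ℤ}

/-- The direction field `d` is periodic with periods `p` and `q` in the two coordinates. -/
structure FieldPeriodic (p q : ℕ) (d : ℤ → ℤ → Heading) : Prop where
  fst : ∀ x y, d (x + p) y = d x y
  snd : ∀ x y, d x (y + q) = d x y

/-- The projection of the grid `ℤ × ℤ` to the torus. -/
def torusMk (p q : ℕ) (z : ℤ × ℤ) : ZMod p × ZMod q := (z.1, z.2)

/-- One step on the torus along the direction field `d`, which is evaluated at the least nonnegative
representatives. -/
def torusStep (d : ℤ → ℤ → Heading) (v : ZMod p × ZMod q) : ZMod p × ZMod q :=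
  (v.1 + (d v.1.val v.2.val).dx, v.2 + (d v.1.val v.2.val).dy)

theorem torusMk_eq_iff :
    torusMk p q (x, y) = torusMk p q (x', y') ↔ (p : ℤ) ∣ x' - x ∧ (q : ℤ) ∣ y' - y := by
  rw [torusMk, torusMk, Prod.mk.injEq, ZMod.intCast_eq_intCast_iff_dvd_sub,
    ZMod.intCast_eq_intCast_iff_dvd_sub]

theorem torusMk_val [NeZero p] [NeZero q] (v : ZMod p × ZMod q) :
    torusMk p q (v.1.val, v.2.val) = v := by
  simp [torusMk]

theorem torusMk_mul_eq_iff (ha : 0 < a) (hb : 0 < b) :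
    torusMk (p * a) (q * b) (a * x, b * y) = torusMk (p * a) (q * b) (a * x', b * y') ↔
      torusMk p q (x, y) = torusMk p q (x', y') := by
  rw [torusMk_eq_iff, torusMk_eq_iff, ← mul_sub, ← mul_sub, mul_comm p, mul_comm q]
  push_cast
  rw [mul_dvd_mul_iff_left (by omega), mul_dvd_mul_iff_left (by omega)]

namespace FieldPeriodic

theorem congr (hd : FieldPeriodic p q d) (h : torusMk p q (x, y) = torusMk p q (x', y')) :
    d x y = d x' y' := by
  obtain ⟨⟨k, hk⟩, l, hl⟩ := torusMk_eq_iff.1 h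
  obtain rfl : x' = x + k * p := by linear_combination hk
  obtain rfl : y' = y + l * q := by linear_combination hl
  have hx := Function.Periodic.int_mul (f := (d · y)) (hd.fst · y) k x
  have hy := Function.Periodic.int_mul (f := d (x + k * p)) (hd.snd _) l y
  exact (hy.trans hx).symm

theorem subdivide (hd : FieldPeriodic p q d) (ha : 0 < a) (hb : 0 < b) :
    FieldPeriodic (p * a) (q * b) (subdivide a b d) where
  fst x y := by
    simp only [_root_.subdivide, Nat.cast_mul, dvd_add_left (dvd_mul_left (a : ℤ) _),
      Int.add_mul_ediv_right x p (c := a) (by omega), hd.fst]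
  snd x y := by
    simp only [_root_.subdivide, Nat.cast_mul, dvd_add_left (dvd_mul_left (b : ℤ) _),
      Int.add_mul_ediv_right y q (c := b) (by omega), hd.snd]

theorem torusMk_edgePoint (hd : FieldPeriodic p q d) (ha : 0 < a) (hb : 0 < b)
    (h : torusMk p q (x, y) = torusMk p q (x', y')) (u : ℕ) :
    torusMk (p * a) (q * b) (edgePoint a b d x y u) =
      torusMk (p * a) (q * b) (edgePoint a b d x' y' u) := by
  have := (torusMk_mul_eq_iff ha hb).2 h
  rw [torusMk_eq_iff] at this
  rwa [edgePoint, edgePoint, hd.congr h, torusMk_eq_iff, add_sub_add_right_eq_sub,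
    add_sub_add_right_eq_sub]

variable [NeZero p] [NeZero q]

theorem val_intCast (hd : FieldPeriodic p q d) (x y : ℤ) :
    d (x : ZMod p).val (y : ZMod q).val = d x y :=
  hd.congr (torusMk_val (torusMk p q (x, y)))

theorem torusStep_torusMk (hd : FieldPeriodic p q d) :
    Function.Semiconj (torusMk p q) (fieldStep d) (torusStep d) := by
  rintro ⟨x, y⟩
  simp only [torusStep, torusMk, fieldStep, hd.val_intCast, Int.cast_add]

end FieldPeriodic

end TorusFields

section SubdividedTorus

variable {p q a b : ℕ} {d : ℤ → ℤ → Heading}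

theorem intCast_mem_multiples_iff {n m : ℕ} [NeZero (n * m)] {x : ℤ} :
    (x : ZMod (n * m)) ∈ multiples (n * m) m ↔ (m : ℤ) ∣ x := by
  rw [multiples, mem_ofPred_eq, ← Int.natCast_dvd_natCast, ZMod.val_intCast, Nat.cast_mul]
  exact EuclideanDomain.dvd_mod_iff (dvd_mul_left _ _)

theorem exists_eq_intCast_of_mem_multiples {n m : ℕ} [NeZero (n * m)] {t : ZMod (n * m)}
    (ht : t ∈ multiples (n * m) m) : ∃ x : ℤ, ((m * x : ℤ) : ZMod (n * m)) = t := by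
  obtain ⟨x, hx⟩ := ht
  exact ⟨x, by rw [← ZMod.natCast_zmod_val t, hx]; push_cast; rfl⟩

theorem exists_eq_intCast_mul_add {n m : ℕ} [NeZero (n * m)] (t : ZMod (n * m)) :
    ∃ (x : ℤ) (i : ℕ), i < m ∧ ((m * x + i : ℤ) : ZMod (n * m)) = t := by
  have hm : 0 < m := (right_ne_zero_of_mul (NeZero.ne (n * m))).bot_lt
  refine ⟨(t.val / m : ℕ), t.val % m, Nat.mod_lt _ hm, ?_⟩
  exact_mod_cast (congrArg Nat.cast (Nat.div_add_mod t.val m)).trans (ZMod.natCast_zmod_val t)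

theorem card_multiples {n m : ℕ} [NeZero (n * m)] : Nat.card (multiples (n * m) m) = n := by
  have hm : 0 < m := (right_ne_zero_of_mul (NeZero.ne (n * m))).bot_lt
  let f (k : Fin n) : multiples (n * m) m :=
    ⟨((m * k : ℕ) : ZMod (n * m)), by
      exact_mod_cast intCast_mem_multiples_iff.2 (Int.natCast_dvd_natCast.2 (dvd_mul_right m k))⟩
  have val_f (k : Fin n) : (f k).1.val = m * k :=
    ZMod.val_natCast_of_lt (by rw [mul_comm n]; exact Nat.mul_lt_mul_of_pos_left k.2 hm)
  refine (Nat.card_congr (.ofBijective f ⟨fun k l h => ?_, fun ⟨t, k, hk⟩ => ?_⟩)).symm.trans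
    (Nat.card_fin n)
  · have := congrArg (fun t => t.1.val) h
    simp only [val_f] at this
    exact Fin.ext (Nat.eq_of_mul_eq_mul_left hm this)
  · have hkn : m * k < m * n := hk ▸ mul_comm n m ▸ t.val_lt
    exact ⟨⟨k, Nat.lt_of_mul_lt_mul_left hkn⟩,
      Subtype.ext (ZMod.val_injective _ ((val_f _).trans hk.symm))⟩

theorem adj_torusMk_edgePoint (hpa : 2 ≤ p * a) (hqb : 2 ≤ q * b) (x y : ℤ) (u : ℕ) :
    (subdividedTorus p q a b).Adj (torusMk _ _ (edgePoint a b d x y u))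
      (torusMk _ _ (edgePoint a b d x y (u + 1))) := by
  have : NeZero (p * a) := ⟨by omega⟩
  have : NeZero (q * b) := ⟨by omega⟩
  have hx := (intCast_mem_multiples_iff (n := p)).2 (dvd_mul_right (a : ℤ) x)
  have hy := (intCast_mem_multiples_iff (n := q)).2 (dvd_mul_right (b : ℤ) y)
  cases hθ : d x y <;> simp only [edgePoint, torusMk, hθ, dx, dy, mul_zero, add_zero]
  · exact Or.inl ⟨(zmodCycle_adj hpa).2 (Or.inl (by push_cast; ring)), rfl, hy⟩
  · exact Or.inl ⟨(zmodCycle_adj hpa).2 (Or.inr (by push_cast; ring)), rfl, hy⟩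
  · exact Or.inr ⟨(zmodCycle_adj hqb).2 (Or.inl (by push_cast; ring)), rfl, hx⟩
  · exact Or.inr ⟨(zmodCycle_adj hqb).2 (Or.inr (by push_cast; ring)), rfl, hx⟩

theorem two_le_mul_add {r : ℕ} [NeZero r] [NeZero a] [NeZero b] : 2 ≤ r * (a + b) :=
  le_mul_of_one_le_of_le (NeZero.pos r) (Nat.add_le_add (NeZero.pos a) (NeZero.pos b))

theorem le_card_edgeSet_subdividedTorus (hpa : 3 ≤ p * a) (hqb : 3 ≤ q * b) :
    p * q * (a + b) ≤ Nat.card (subdividedTorus p q a b).edgeSet := by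
  have : NeZero (p * a) := ⟨by omega⟩
  have : NeZero (q * b) := ⟨by omega⟩
  have : Fact (1 < p * a) := ⟨by omega⟩
  have : Fact (1 < q * b) := ⟨by omega⟩
  let f : (ZMod (p * a) × multiples (q * b) b) ⊕ (multiples (p * a) a × ZMod (q * b)) →
      (subdividedTorus p q a b).edgeSet := Sum.elim
    (fun z => ⟨s((z.1, z.2), (z.1 + 1, z.2)),
      Or.inl ⟨zmodCycle_adj_add_one (by omega) _, rfl, z.2.2⟩⟩)
    (fun z => ⟨s((z.1, z.2), (z.1, z.2 + 1)),
      Or.inr ⟨zmodCycle_adj_add_one (by omega) _, rfl, z.1.2⟩⟩)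
  have hf : Function.Injective f := by
    have two_ne {n : ℕ} (hn : 3 ≤ n) (x : ZMod n) : x + 1 + 1 ≠ x := by
      rw [add_assoc, one_add_one_eq_two, Ne, add_eq_left]
      exact fun h => absurd (Nat.le_of_dvd two_pos ((ZMod.natCast_eq_zero_iff 2 n).1 h)) (by omega)
    rintro (⟨x, y, hy⟩ | ⟨⟨x, hx⟩, y⟩) (⟨x', y', hy'⟩ | ⟨⟨x', hx'⟩, y'⟩) h <;>
      simp only [f, Sum.elim_inl, Sum.elim_inr] at h <;> grind
  refine le_trans (le_of_eq ?_) (Nat.card_le_card_of_injective f hf)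
  rw [Nat.card_sum, Nat.card_prod, Nat.card_prod, card_multiples, card_multiples, Nat.card_zmod,
    Nat.card_zmod]
  ring

end SubdividedTorus

section Patterns

variable {K : Type} {p q r a b : ℕ} {d : Bool → ℤ → ℤ → Heading} {colour : K → Bool}
  {base : K → ℤ × ℤ}

/-- Two periodic direction fields on `ℤ × ℤ` such that every edge of the toroidal `p × q` grid is
traversed by one of them, together with base points on the torus from which the trajectories of the
fields close up after `r` horizontal and `r` vertical steps and between them visit every vertex once
for each field. The base point of `k` belongs to the field `d (colour k)`. -/
structure IsTorusPattern (p q r : ℕ) (d : Bool → ℤ → ℤ → Heading) (colour : K → Bool)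
    (base : K → ℤ × ℤ) : Prop where
  periodic : ∀ c, FieldPeriodic p q (d c)
  cover_fst : ∀ x y, ∃ c, d c x y = east ∨ d c (x + 1) y = west
  cover_snd : ∀ x y, ∃ c, d c x y = north ∨ d c x (y + 1) = south
  reach : ∀ c x y, ∃ k h v x' y', colour k = c ∧ Run (d c) (base k).1 (base k).2 h v x' y' ∧
    torusMk p q (x', y') = torusMk p q (x, y)
  ret : ∀ k, ∃ x y, Run (d (colour k)) (base k).1 (base k).2 r r x y ∧
    torusMk p q (x, y) = torusMk p q (base k)
  card : Nat.card K * r = p * q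

/-- The pattern of trajectories alternates between horizontal and vertical steps, so that the two
trajectories through a vertex are told apart by their next step when they arrive there after equally
many horizontal and vertical steps. -/
structure IsAlternating (p q : ℕ) (d : Bool → ℤ → ℤ → Heading) (colour : K → Bool)
    (base : K → ℤ × ℤ) : Prop where
  run : ∀ k n, ∃ x y, Run (d (colour k)) (base k).1 (base k).2 n n x y ∧
    Horizontal (d (colour k) x y)
  colour_eq : ∀ {c c' x y}, Horizontal (d c x y) → Horizontal (d c' x y) → c = c'
  reach : ∀ x y, ∃ k n x' y', Run (d (colour k)) (base k).1 (base k).2 n n x' y' ∧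
    torusMk p q (x', y') = torusMk p q (x, y)

/-- The edge of the toroidal grid that leaves the vertex `v` in the direction `θ`. An edge is
encoded by its left or lower end, with `true` for horizontal edges. -/
def torusEdge (v : ZMod p × ZMod q) : Heading → Bool × ZMod p × ZMod q
  | east => (true, v)
  | west => (true, v.1 - 1, v.2)
  | north => (false, v)
  | south => (false, v.1, v.2 - 1)

/-- The edge of the toroidal grid along which the field `d e.1` leaves the vertex `e.2`. -/
def leavingEdge (d : Bool → ℤ → ℤ → Heading) (e : Bool × ZMod p × ZMod q) :
    Bool × ZMod p × ZMod q :=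
  torusEdge e.2 (d e.1 e.2.1.val e.2.2.val)

/-- The closed trajectory of index `k` of a pattern on the subdivided torus. -/
def patternCycle (p q r a b : ℕ) (d : Bool → ℤ → ℤ → Heading) (colour : K → Bool)
    (base : K → ℤ × ℤ) (k : K) (t : ZMod (r * (a + b))) : ZMod (p * a) × ZMod (q * b) :=
  (torusStep (subdivide a b (d (colour k))))^[t.val]
    (torusMk _ _ (edgePoint a b (d (colour k)) (base k).1 (base k).2 0))

namespace IsTorusPattern

theorem leavingEdge_torusMk [NeZero p] [NeZero q] (h : IsTorusPattern p q r d colour base)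
    (c : Bool) (x y : ℤ) :
    leavingEdge d (c, torusMk p q (x, y)) = torusEdge (torusMk p q (x, y)) (d c x y) := by
  simp only [leavingEdge, torusMk, (h.periodic c).val_intCast]

theorem leavingEdge_surjective [NeZero p] [NeZero q] (h : IsTorusPattern p q r d colour base) :
    Function.Surjective (leavingEdge (p := p) (q := q) d) := by
  rintro ⟨_ | _, v⟩ <;> rw [← torusMk_val v] <;>
    generalize (v.1.val : ℤ) = x <;> generalize (v.2.val : ℤ) = y
  · rcases h.cover_snd x y with ⟨c, hc | hc⟩
    · exact ⟨(c, torusMk p q (x, y)), by rw [h.leavingEdge_torusMk, hc, torusEdge]⟩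
    · exact ⟨(c, torusMk p q (x, y + 1)), by
        rw [h.leavingEdge_torusMk, hc, torusEdge]; simp [torusMk]⟩
  · rcases h.cover_fst x y with ⟨c, hc | hc⟩
    · exact ⟨(c, torusMk p q (x, y)), by rw [h.leavingEdge_torusMk, hc, torusEdge]⟩
    · exact ⟨(c, torusMk p q (x + 1, y)), by
        rw [h.leavingEdge_torusMk, hc, torusEdge]; simp [torusMk]⟩

-- The torus has as many edges as there are pairs of a field and a vertex, so covering all edges
-- forces the two fields to leave all vertices along different edges.
theorem unopposed [NeZero p] [NeZero q] (h : IsTorusPattern p q r d colour base) (c : Bool) :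
    Unopposed (d c) := by
  have inj := Finite.injective_iff_surjective.2 h.leavingEdge_surjective
  have eq_of_torusEdge {x y x' y' : ℤ} (e : torusEdge (torusMk p q (x, y)) (d c x y) =
      torusEdge (torusMk p q (x', y')) (d c x' y')) : d c x y = d c x' y' := by
    rw [← h.leavingEdge_torusMk, ← h.leavingEdge_torusMk] at e
    exact (h.periodic c).congr (Prod.ext_iff.1 (inj e)).2
  constructor <;> intro x y h₁ h₂ <;>
    refine absurd (h₁.symm.trans ((eq_of_torusEdge ?_).trans h₂)) Heading.noConfusion <;>
    simp [h₁, h₂, torusEdge, torusMk]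

variable [NeZero p] [NeZero q] [NeZero a] [NeZero b]

theorem patternCycle_natCast (h : IsTorusPattern p q r d colour base) (k : K) (n : ℕ) :
    patternCycle p q r a b d colour base k n = torusMk (p * a) (q * b)
      ((fieldStep (subdivide a b (d (colour k))))^[n]
        (edgePoint a b (d (colour k)) (base k).1 (base k).2 0)) := by
  have periodic := (h.periodic (colour k)).subdivide (NeZero.pos a) (NeZero.pos b)
  have semiconj n := (periodic.torusStep_torusMk.iterate_right n).eq
  obtain ⟨x, y, run, hxy⟩ := h.ret k
  have closed : Function.IsPeriodicPt (torusStep (subdivide a b (d (colour k)))) (r * (a + b))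
      (torusMk (p * a) (q * b) (edgePoint a b (d (colour k)) (base k).1 (base k).2 0)) := by
    rw [Function.IsPeriodicPt, Function.IsFixedPt, ← semiconj, mul_add,
      run.iterate (h.unopposed _) (NeZero.pos a) (NeZero.pos b)]
    exact (h.periodic _).torusMk_edgePoint (NeZero.pos a) (NeZero.pos b) hxy 0
  rw [patternCycle, ZMod.val_natCast, closed.iterate_mod_apply, semiconj]

theorem patternCycle_add_one [NeZero r]
    (h : IsTorusPattern p q r d colour base) (k : K) (t : ZMod (r * (a + b))) :
    patternCycle p q r a b d colour base k (t + 1) =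
      torusStep (subdivide a b (d (colour k))) (patternCycle p q r a b d colour base k t) := by
  rw [← ZMod.natCast_zmod_val t, ← Nat.cast_succ, h.patternCycle_natCast,
    h.patternCycle_natCast, Function.iterate_succ_apply']
  exact ((h.periodic _).subdivide (NeZero.pos a) (NeZero.pos b)).torusStep_torusMk _

theorem exists_patternCycle_eq_edgePoint [NeZero r]
    (h : IsTorusPattern p q r d colour base) (k : K) (t : ZMod (r * (a + b))) :
    ∃ x y u,
      patternCycle p q r a b d colour base k t =
        torusMk _ _ (edgePoint a b (d (colour k)) x y u) ∧
      patternCycle p q r a b d colour base k (t + 1) =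
        torusMk _ _ (edgePoint a b (d (colour k)) x y (u + 1)) := by
  have hd := h.unopposed (colour k)
  obtain ⟨x, y, u, hu, e⟩ := hd.exists_iterate_eq_edgePoint (NeZero.pos a) (NeZero.pos b)
    (x := (base k).1) (y := (base k).2) t.val
  refine ⟨x, y, u, ?_⟩
  rw [← hd.fieldStep_edgePoint (NeZero.pos a) (NeZero.pos b) hu, ← e,
    ← Function.iterate_succ_apply' (fieldStep _), ← h.patternCycle_natCast,
    ← h.patternCycle_natCast, Nat.cast_succ, ZMod.natCast_zmod_val]
  exact ⟨rfl, rfl⟩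

theorem exists_edgePoint_eq_patternCycle
    (h : IsTorusPattern p q r d colour base) (c : Bool) (x y : ℤ) {u : ℕ}
    (hu : u < (d c x y).weight a b) :
    ∃ k t,
      patternCycle p q r a b d colour base k t = torusMk _ _ (edgePoint a b (d c) x y u) ∧
      patternCycle p q r a b d colour base k (t + 1) =
        torusMk _ _ (edgePoint a b (d c) x y (u + 1)) := by
  obtain ⟨k, i, j, x', y', rfl, run, hxy⟩ := h.reach c x y
  have hd := h.unopposed (colour k)
  have key {w : ℕ} (hw : w ≤ (d (colour k) x y).weight a b) :
      patternCycle p q r a b d colour base k ((w + (i * a + j * b) : ℕ) : ZMod (r * (a + b))) =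
        torusMk _ _ (edgePoint a b (d (colour k)) x y w) := by
    rw [h.patternCycle_natCast, Function.iterate_add_apply,
      run.iterate hd (NeZero.pos a) (NeZero.pos b),
      hd.iterate_edgePoint (NeZero.pos a) (NeZero.pos b) ((h.periodic _).congr hxy ▸ hw)]
    exact (h.periodic _).torusMk_edgePoint (NeZero.pos a) (NeZero.pos b) hxy w
  exact ⟨k, _, key hu.le, by rw [← Nat.cast_succ, ← Nat.succ_add]; exact key hu⟩

theorem exists_edgePoint_eq_horizontal
    (h : IsTorusPattern p q r d colour base) (x : ZMod (p * a)) {y : ZMod (q * b)}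
    (hy : y ∈ multiples (q * b) b) :
    ∃ c x' y' u, u < (d c x' y').weight a b ∧
      s(torusMk (p * a) (q * b) (edgePoint a b (d c) x' y' u),
        torusMk (p * a) (q * b) (edgePoint a b (d c) x' y' (u + 1))) = s((x, y), (x + 1, y)) := by
  obtain ⟨y, rfl⟩ := exists_eq_intCast_of_mem_multiples hy
  obtain ⟨x, i, hi, rfl⟩ := exists_eq_intCast_mul_add x
  obtain ⟨c, hc | hc⟩ := h.cover_fst x y
  · refine ⟨c, x, y, i, by rwa [hc], ?_⟩
    simp only [edgePoint, torusMk, hc, dx, dy]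
    push_cast
    ring_nf
  · refine ⟨c, x + 1, y, a - 1 - i, by rw [hc, weight]; omega, ?_⟩
    rw [Sym2.eq_swap]
    simp only [edgePoint, torusMk, hc, dx, dy, show ((a - 1 - i : ℕ) : ℤ) = a - 1 - i by omega,
      Nat.cast_succ]
    push_cast
    ring_nf

theorem exists_edgePoint_eq_vertical
    (h : IsTorusPattern p q r d colour base) {x : ZMod (p * a)} (hx : x ∈ multiples (p * a) a)
    (y : ZMod (q * b)) :
    ∃ c x' y' u, u < (d c x' y').weight a b ∧
      s(torusMk (p * a) (q * b) (edgePoint a b (d c) x' y' u),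
        torusMk (p * a) (q * b) (edgePoint a b (d c) x' y' (u + 1))) = s((x, y), (x, y + 1)) := by
  obtain ⟨x, rfl⟩ := exists_eq_intCast_of_mem_multiples hx
  obtain ⟨y, i, hi, rfl⟩ := exists_eq_intCast_mul_add y
  obtain ⟨c, hc | hc⟩ := h.cover_snd x y
  · refine ⟨c, x, y, i, by rwa [hc], ?_⟩
    simp only [edgePoint, torusMk, hc, dx, dy]
    push_cast
    ring_nf
  · refine ⟨c, x, y + 1, b - 1 - i, by rw [hc, weight]; omega, ?_⟩
    rw [Sym2.eq_swap]
    simp only [edgePoint, torusMk, hc, dx, dy, show ((b - 1 - i : ℕ) : ℤ) = b - 1 - i by omega,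
      Nat.cast_succ]
    push_cast
    ring_nf

theorem neZero (h : IsTorusPattern p q r d colour base) : NeZero r :=
  ⟨right_ne_zero_of_mul (h.card.trans_ne (NeZero.ne (p * q)))⟩

theorem exists_edgePoint_of_mem_multiples [NeZero r] (h : IsTorusPattern p q r d colour base)
    (alt : IsAlternating p q d colour base) (k : K) {t : ZMod (r * (a + b))}
    (ht : t ∈ multiples (r * (a + b)) (a + b)) :
    ∃ x y, Horizontal (d (colour k) x y) ∧ patternCycle p q r a b d colour base k t =
      torusMk _ _ (edgePoint a b (d (colour k)) x y 0) := by
  obtain ⟨n, hn⟩ := ht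
  obtain ⟨x, y, run, hθ⟩ := alt.run k n
  refine ⟨x, y, hθ, ?_⟩
  rw [← ZMod.natCast_zmod_val t, hn, h.patternCycle_natCast, mul_comm (a + b), mul_add,
    run.iterate (h.unopposed _) (NeZero.pos a) (NeZero.pos b)]

theorem exists_patternCycle_of_mem_gridVertices [NeZero r]
    (h : IsTorusPattern p q r d colour base) (alt : IsAlternating p q d colour base)
    {v : ZMod (p * a) × ZMod (q * b)} (hv : v ∈ gridVertices p q a b) :
    ∃ k, ∃ t ∈ multiples (r * (a + b)) (a + b), patternCycle p q r a b d colour base k t = v := by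
  obtain ⟨x, hx⟩ := exists_eq_intCast_of_mem_multiples hv.1
  obtain ⟨y, hy⟩ := exists_eq_intCast_of_mem_multiples hv.2
  obtain ⟨k, n, x', y', run, hxy⟩ := alt.reach x y
  refine ⟨k, (n * a + n * b : ℕ), ?_, ?_⟩
  · rw [← mul_add, ← Int.cast_natCast, intCast_mem_multiples_iff]
    exact Int.natCast_dvd_natCast.2 (dvd_mul_left _ _)
  · rw [h.patternCycle_natCast, run.iterate (h.unopposed _) (NeZero.pos a) (NeZero.pos b),
      edgePoint_zero, (torusMk_mul_eq_iff (NeZero.pos a) (NeZero.pos b)).2 hxy]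
    exact Prod.ext hx hy

variable (hpa : 3 ≤ p * a) (hqb : 3 ≤ q * b)
include hpa hqb

theorem exists_patternCycle_of_adj (h : IsTorusPattern p q r d colour base)
    {v w : ZMod (p * a) × ZMod (q * b)} (hvw : (subdividedTorus p q a b).Adj v w) :
    ∃ k t, s(patternCycle p q r a b d colour base k t,
      patternCycle p q r a b d colour base k (t + 1)) = s(v, w) := by
  suffices ∃ c x y u, u < (d c x y).weight a b ∧
      s(torusMk (p * a) (q * b) (edgePoint a b (d c) x y u),
        torusMk (p * a) (q * b) (edgePoint a b (d c) x y (u + 1))) = s(v, w) by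
    obtain ⟨c, x, y, u, hu, e⟩ := this
    obtain ⟨k, t, ht, ht'⟩ := h.exists_edgePoint_eq_patternCycle c x y hu
    exact ⟨k, t, by rw [ht, ht', e]⟩
  rcases v with ⟨x, y⟩
  rcases w with ⟨x', y'⟩
  rcases hvw with ⟨hx, hyy, hy⟩ | ⟨hy, hxx, hx⟩ <;> dsimp only at *
  · subst hyy
    rcases (zmodCycle_adj (by omega)).1 hx with rfl | rfl
    · exact h.exists_edgePoint_eq_horizontal x hy
    · rw [Sym2.eq_swap]
      exact h.exists_edgePoint_eq_horizontal x' hy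
  · subst hxx
    rcases (zmodCycle_adj (by omega)).1 hy with rfl | rfl
    · exact h.exists_edgePoint_eq_vertical hx y
    · rw [Sym2.eq_swap]
      exact h.exists_edgePoint_eq_vertical hx y'

theorem adj_patternCycle [NeZero r] (h : IsTorusPattern p q r d colour base) (k : K)
    (t : ZMod (r * (a + b))) :
    (subdividedTorus p q a b).Adj (patternCycle p q r a b d colour base k t)
      (patternCycle p q r a b d colour base k (t + 1)) := by
  obtain ⟨x, y, u, e, e'⟩ := h.exists_patternCycle_eq_edgePoint k t
  rw [e, e']
  exact adj_torusMk_edgePoint (by omega) (by omega) x y u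

-- The trajectories have as many steps in total as the subdivided torus has edges.
theorem patternCycle_edge_injective [Finite K] [NeZero r] (h : IsTorusPattern p q r d colour base) :
    Function.Injective fun e : K × ZMod (r * (a + b)) =>
      s(patternCycle p q r a b d colour base e.1 e.2,
        patternCycle p q r a b d colour base e.1 (e.2 + 1)) := by
  let f (e : K × ZMod (r * (a + b))) : (subdividedTorus p q a b).edgeSet :=
    ⟨s(_, _), h.adj_patternCycle hpa hqb e.1 e.2⟩
  have surj : Function.Surjective f := by
    rintro ⟨e, he⟩
    induction e with | _ v w
    obtain ⟨k, t, hkt⟩ := h.exists_patternCycle_of_adj hpa hqb he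
    exact ⟨(k, t), Subtype.ext hkt⟩
  have card : Nat.card (K × ZMod (r * (a + b))) ≤ Nat.card (subdividedTorus p q a b).edgeSet := by
    rw [Nat.card_prod, Nat.card_zmod, ← mul_assoc, h.card]
    exact le_card_edgeSet_subdividedTorus hpa hqb
  exact Subtype.val_injective.comp ((surj.bijective_of_nat_card_le card).injective)

theorem isTiling [Finite K] (h : IsTorusPattern p q r d colour base) :
    IsTiling (zmodCycle (r * (a + b))) (subdividedTorus p q a b)
      (patternCycle p q r a b d colour base) := by
  have : NeZero r := h.neZero
  have inj := h.patternCycle_edge_injective hpa hqb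
  refine .zmodCycle two_le_mul_add (h.adj_patternCycle hpa hqb) (fun k t t' e => ?_)
    (fun {k t k' t'} e => congrArg Prod.fst (@inj (k, t) (k', t') e))
    (h.exists_patternCycle_of_adj hpa hqb)
  have : (k, t) = (k, t') := inj <| by
    simp only [h.patternCycle_add_one, e]
  exact congrArg Prod.snd this

theorem isAnchored [Finite K] [NeZero r] (h : IsTorusPattern p q r d colour base)
    (alt : IsAlternating p q d colour base) :
    IsAnchored (zmodCycle (r * (a + b))) (multiples (r * (a + b)) (a + b)) (gridVertices p q a b)
      (patternCycle p q r a b d colour base) := by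
  refine ⟨fun t _ => ⟨t + 1, zmodCycle_adj_add_one two_le_mul_add t⟩, ?_, ?_, fun v hv => ?_⟩
  · rintro ⟨k, t⟩ ⟨-, ht⟩
    obtain ⟨x, y, -, e⟩ := h.exists_edgePoint_of_mem_multiples alt k ht
    simp only [e, edgePoint_zero]
    exact ⟨intCast_mem_multiples_iff.2 (dvd_mul_right _ _),
      intCast_mem_multiples_iff.2 (dvd_mul_right _ _)⟩
  · rintro ⟨k, t⟩ ⟨-, ht⟩ ⟨k', t'⟩ ⟨-, ht'⟩ hv
    obtain ⟨x, y, hθ, e⟩ := h.exists_edgePoint_of_mem_multiples alt k ht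
    obtain ⟨x', y', hθ', e'⟩ := h.exists_edgePoint_of_mem_multiples alt k' ht'
    have hxy : torusMk p q (x, y) = torusMk p q (x', y') := by
      rw [← torusMk_mul_eq_iff (NeZero.pos a) (NeZero.pos b), ← edgePoint_zero, ← edgePoint_zero,
        ← e, ← e']
      exact hv
    have hk : colour k = colour k' := alt.colour_eq ((h.periodic _).congr hxy ▸ hθ) hθ'
    refine h.patternCycle_edge_injective hpa hqb ?_
    simp only [h.patternCycle_add_one, show patternCycle _ _ _ _ _ _ _ _ k t = _ from hv, hk]
  · obtain ⟨k, t, ht, e⟩ := h.exists_patternCycle_of_mem_gridVertices alt hv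
    exact ⟨(k, t), mk_mem_prod trivial ht, e⟩

theorem anchoredCycles [Finite K] (h : IsTorusPattern p q r d colour base)
    (alt : IsAlternating p q d colour base) :
    AnchoredCycles r (a + b) (subdividedTorus p q a b) (gridVertices p q a b) := by
  have : NeZero r := h.neZero
  exact ⟨K, inferInstance, _, h.isTiling hpa hqb, h.isAnchored hpa hqb alt⟩

end IsTorusPattern

end Patterns

section Zigzags

variable {H : ℤ → ℤ} {c : Bool} {x y s : ℤ} {p q m Q a b : ℕ}

/-- The direction field of paths that step alternately to the east and along the graph of the height
function `H`. The eastward steps start at the points whose parity is given by `c`. -/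
def zigzag (H : ℤ → ℤ) (c : Bool) (x y : ℤ) : Heading :=
  if Even (x + y) ↔ c then east else if H (x - 1) < H x then north else south

/-- The height function `H` changes by one in each step and by `s` in each period `p`. -/
structure IsZigzagHeight (p : ℕ) (s : ℤ) (H : ℤ → ℤ) : Prop where
  zero : H 0 = 0
  step : ∀ x, H (x + 1) = H x + 1 ∨ H (x + 1) = H x - 1
  add_period : ∀ x, H (x + p) = H x + s

theorem horizontal_zigzag_iff : Horizontal (zigzag H c x y) ↔ (Even (x + y) ↔ c) := by
  unfold zigzag Horizontal
  split_ifs <;> simp [*]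

namespace IsZigzagHeight

variable (hH : IsZigzagHeight p s H)
include hH

theorem even_add_self (x : ℤ) : Even (x + H x) := by
  induction x using Int.induction_on with
  | zero => simp [hH.zero]
  | succ n ih => rcases hH.step n with h | h <;> rw [h] <;> grind
  | pred n ih =>
    have := hH.step (-n - 1)
    rw [sub_add_cancel] at this
    grind

theorem add_mul_period (x : ℤ) (n : ℕ) : H (x + p * n) = H x + s * n := by
  induction n with
  | zero => simp
  | succ n ih =>
    have := hH.add_period (x + p * n)
    rw [ih] at this
    push_cast
    rw [mul_add_one, ← add_assoc, this]
    ring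

theorem run_step (h : Even (x + y) ↔ c) :
    Run (zigzag H c) x y 1 1 (x + 1) (y + (H (x + 1) - H x)) := by
  have h' : ¬(Even (x + 1 + y) ↔ c) := by grind
  have first : Run (zigzag H c) x y 1 0 (x + 1) y := Run.refl.east (if_pos h)
  rcases hH.step x with e | e
  · have := first.north (by simp [zigzag, h', e])
    rwa [e, add_sub_cancel_left]
  · have := first.south (by simp [zigzag, h', e])
    rwa [e, sub_sub_cancel_left, ← sub_eq_add_neg]

theorem run_zigzag (h : Even (x + y) ↔ c) (n : ℕ) :
    Run (zigzag H c) x y n n (x + n) (y + (H (x + n) - H x)) := by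
  induction n with
  | zero => simpa using Run.refl
  | succ n ih =>
    have h' : Even (x + n + (y + (H (x + n) - H x))) ↔ c := by
      have := hH.even_add_self x
      have := hH.even_add_self (x + n)
      grind
    have := ih.trans (hH.run_step h')
    rw [add_assoc y, sub_add_sub_cancel', add_assoc x] at this
    exact_mod_cast this

omit hH in
theorem run_from_axis (hH : IsZigzagHeight p s H) (k n : ℕ) :
    Run (zigzag H (Even k)) 0 k n n n (k + H n) := by
  simpa [hH.zero] using hH.run_zigzag (x := 0) (y := k) (c := decide (Even k)) (by simp) n

theorem zigzag_from_axis (k n : ℕ) : zigzag H (Even k) n (k + H n) = east := by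
  have := hH.even_add_self n
  exact if_pos (by rw [decide_eq_true_iff, ← Int.even_coe_nat]; grind)

theorem fieldPeriodic (hp : Even p) (hq : Even q) (c : Bool) : FieldPeriodic p q (zigzag H c) where
  fst x y := by
    have hx := hH.add_period (x - 1)
    rw [sub_add_eq_add_sub] at hx
    have hp' : Even (p : ℤ) := mod_cast hp
    have : Even (x + p + y) ↔ Even (x + y) := by grind
    simp only [zigzag, this, hx, hH.add_period, add_lt_add_iff_right]
  snd x y := by
    have hq' : Even (q : ℤ) := mod_cast hq
    have : Even (x + (y + q)) ↔ Even (x + y) := by grind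
    simp only [zigzag, this]

theorem exists_from_axis (hp : 0 < p) (reach : ∀ y : ℤ, ∃ k : Fin m, ∃ j : ℕ,
    (q : ℤ) ∣ y - (k + s * j)) (x y : ℤ) :
    ∃ (k : Fin m) (n : ℕ), torusMk p q (n, k + H n) = torusMk p q (x, y) := by
  obtain ⟨k, j, hkj⟩ := reach (y - H (x % p))
  have hn : (((x % p).toNat + p * j : ℕ) : ℤ) = x % p + p * j := by
    rw [Nat.cast_add, Int.toNat_of_nonneg (Int.emod_nonneg x (by omega)), Nat.cast_mul]
  refine ⟨k, (x % p).toNat + p * j, torusMk_eq_iff.2 ⟨?_, ?_⟩⟩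
  · rw [hn, ← sub_sub]
    exact (Int.dvd_self_sub_emod).sub (dvd_mul_right _ _)
  · rw [hn, hH.add_mul_period]
    convert hkj using 1
    ring

theorem exists_aligned_from_axis (hp : Even p) (hp₀ : 0 < p) (hq : Even q)
    (reach : ∀ y : ℤ, ∃ k : Fin m, ∃ j : ℕ, (q : ℤ) ∣ y - (k + s * j)) (h : Even (x + y) ↔ c) :
    ∃ (k : Fin m) (n : ℕ), decide (Even k.1) = c ∧
      torusMk p q (n, k + H n) = torusMk p q (x, y) := by
  obtain ⟨k, n, hkn⟩ := hH.exists_from_axis hp₀ reach x y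
  refine ⟨k, n, ?_, hkn⟩
  have := hH.even_add_self n
  obtain ⟨hx, hy⟩ := torusMk_eq_iff.1 hkn
  have hx' : 2 ∣ x - n := (Int.natCast_dvd_natCast.2 hp.two_dvd).trans hx
  have hy' : 2 ∣ y - (k + H n) := (Int.natCast_dvd_natCast.2 hq.two_dvd).trans hy
  grind

theorem isTorusPattern (hp : Even p) (hp₀ : 0 < p) (hq : Even q) (hqm : q = m * Q)
    (hsQ : (q : ℤ) ∣ s * Q) (reach : ∀ y : ℤ, ∃ k : Fin m, ∃ j : ℕ, (q : ℤ) ∣ y - (k + s * j)) :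
    IsTorusPattern p q (p * Q) (zigzag H) (fun k : Fin m => Even k.1) (fun k => (0, k)) where
  periodic := hH.fieldPeriodic hp hq
  cover_fst x y := ⟨Even (x + y), Or.inl (if_pos (by simp))⟩
  cover_snd x y := by
    by_cases h : H (x - 1) < H x
    · exact ⟨¬Even (x + y), Or.inl ((if_neg (by grind)).trans (if_pos h))⟩
    · exact ⟨Even (x + y), Or.inr ((if_neg (by grind)).trans (if_neg h))⟩
  reach c x y := by
    by_cases h : Even (x + y) ↔ c
    · obtain ⟨k, n, rfl, hkn⟩ := hH.exists_aligned_from_axis hp hp₀ hq reach h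
      exact ⟨k, n, n, n, k + H n, rfl, hH.run_from_axis k n, hkn⟩
    · obtain ⟨k, n, rfl, hkn⟩ :=
        hH.exists_aligned_from_axis hp hp₀ hq reach (x := x - 1) (y := y) (c := c) (by grind)
      refine ⟨k, n + 1, n, n + 1, k + H n, rfl,
        (hH.run_from_axis k n).east (hH.zigzag_from_axis k n), ?_⟩
      rw [torusMk_eq_iff] at hkn ⊢
      rwa [sub_right_comm, sub_sub] at hkn
  ret k := by
    refine ⟨_, _, hH.run_from_axis k (p * Q), torusMk_eq_iff.2 ⟨by simp, ?_⟩⟩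
    have := hH.add_mul_period 0 Q
    rw [zero_add, hH.zero, zero_add] at this
    simpa [this] using hsQ
  card := by rw [Nat.card_fin, hqm]; ring

theorem isAlternating (hp₀ : 0 < p)
    (reach : ∀ y : ℤ, ∃ k : Fin m, ∃ j : ℕ, (q : ℤ) ∣ y - (k + s * j)) :
    IsAlternating p q (zigzag H) (fun k : Fin m => Even k.1) (fun k => (0, k)) where
  run k n := ⟨_, _, hH.run_from_axis k n, Or.inl (hH.zigzag_from_axis k n)⟩
  colour_eq h h' := Bool.eq_iff_iff.2
    ((horizontal_zigzag_iff.1 h).symm.trans (horizontal_zigzag_iff.1 h'))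
  reach x y := by
    obtain ⟨k, n, h⟩ := hH.exists_from_axis hp₀ reach x y
    exact ⟨k, n, _, _, hH.run_from_axis k n, h⟩

omit hH in
theorem anchoredCycles (hH : IsZigzagHeight p s H) (hp : Even p) (hq : Even q) (hqm : q = m * Q)
    (hsQ : (q : ℤ) ∣ s * Q) (reach : ∀ y : ℤ, ∃ k : Fin m, ∃ j : ℕ, (q : ℤ) ∣ y - (k + s * j))
    (hpa : 3 ≤ p * a) (hqb : 3 ≤ q * b) :
    AnchoredCycles (p * Q) (a + b) (subdividedTorus p q a b) (gridVertices p q a b) := by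
  obtain ⟨hp₀, ha⟩ := mul_ne_zero_iff.1 (show p * a ≠ 0 by omega)
  obtain ⟨hq₀, hb⟩ := mul_ne_zero_iff.1 (show q * b ≠ 0 by omega)
  have : NeZero p := ⟨hp₀⟩
  have : NeZero q := ⟨hq₀⟩
  have : NeZero a := ⟨ha⟩
  have : NeZero b := ⟨hb⟩
  exact (hH.isTorusPattern hp hp₀.bot_lt hq hqm hsQ reach).anchoredCycles hpa hqb
    (hH.isAlternating hp₀.bot_lt reach)

end IsZigzagHeight

theorem isZigzagHeight_strip (hp : Even p) : IsZigzagHeight p 0 (fun x => x % 2) where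
  zero := rfl
  step x := by omega
  add_period x := by
    obtain ⟨e, rfl⟩ := hp
    push_cast
    omega

theorem isZigzagHeight_spiral (hp : Even p) (hp₀ : 0 < p) :
    IsZigzagHeight p 2 (fun x => x % 2 + 2 * (x / p)) where
  zero := by simp
  step x := by
    have hx := Int.mul_ediv_add_emod x p
    by_cases h : x % p + 1 < p
    · have : (x + 1) / p = x / p := by
        have := Int.emod_nonneg x (b := p) (by omega)
        rw [← hx, add_assoc, mul_add_ediv (by omega) h, hx]
      omega
    · have hx₁ : x + 1 = p * (x / p + 1) := by
        have := Int.emod_lt_of_pos x (b := p) (by omega)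
        linear_combination -hx + (by omega : x % p + 1 = p)
      have h₁ : (x + 1) / p = x / p + 1 := by
        rw [hx₁, Int.mul_ediv_cancel_left _ (by omega)]
      have h₂ : 2 ∣ x + 1 := hx₁ ▸ (Int.natCast_dvd_natCast.2 hp.two_dvd).mul_right _
      omega
  add_period x := by
    have h : (x + p) / p = x / p + 1 := by
      rw [Int.add_ediv_of_dvd_right (dvd_refl _), Int.ediv_self (by omega)]
    obtain ⟨e, rfl⟩ := hp
    push_cast at h ⊢
    rw [h]
    omega

theorem anchoredCycles_strips (hp : Even p) (hq : Even q) (hpa : 3 ≤ p * a) (hqb : 3 ≤ q * b) :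
    AnchoredCycles p (a + b) (subdividedTorus p q a b) (gridVertices p q a b) := by
  have hq₀ : 0 < q := Nat.pos_of_mul_pos_right (Nat.zero_lt_of_lt hqb)
  have reach (y : ℤ) : ∃ k : Fin q, ∃ j : ℕ, (q : ℤ) ∣ y - (k + 0 * j) := by
    refine ⟨⟨(y % q).toNat, by have := Int.emod_lt_of_pos y (b := q) (by omega); omega⟩, 0, ?_⟩
    rw [zero_mul, add_zero, Int.toNat_of_nonneg (Int.emod_nonneg y (by omega))]
    exact Int.dvd_self_sub_emod
  simpa only [mul_one] using (isZigzagHeight_strip hp).anchoredCycles hp hq (mul_one q).symm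
    (by simp) reach hpa hqb

theorem anchoredCycles_spirals (hp : Even p) (hpa : 3 ≤ p * a) (hqb : 3 ≤ 2 * Q * b) :
    AnchoredCycles (p * Q) (a + b) (subdividedTorus p (2 * Q) a b)
      (gridVertices p (2 * Q) a b) := by
  have hp₀ : 0 < p := Nat.pos_of_mul_pos_right (Nat.zero_lt_of_lt hpa)
  have hQ₀ : 0 < 2 * Q := Nat.pos_of_mul_pos_right (Nat.zero_lt_of_lt hqb)
  have reach (y : ℤ) : ∃ k : Fin 2, ∃ j : ℕ, ((2 * Q : ℕ) : ℤ) ∣ y - (k + 2 * j) := by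
    refine ⟨⟨(y % 2).toNat, by omega⟩, (y / 2 % Q).toNat, y / 2 / Q, ?_⟩
    rw [Int.toNat_of_nonneg (Int.emod_nonneg y (by omega)),
      Int.toNat_of_nonneg (Int.emod_nonneg _ (by omega))]
    push_cast
    linear_combination -(Int.mul_ediv_add_emod y 2) - 2 * Int.mul_ediv_add_emod (y / 2) Q
  exact (isZigzagHeight_spiral hp hp₀).anchoredCycles hp (even_two_mul Q) rfl (by simp) reach hpa
    hqb

end Zigzags

namespace Heading

/-- The reflection in a vertical line. -/
def mirror : Heading → Heading
  | east => west
  | west => east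
  | north => north
  | south => south

/-- The reflection in a horizontal line. -/
def flip : Heading → Heading
  | east => east
  | west => west
  | north => south
  | south => north

theorem flip_flip (θ : Heading) : θ.flip.flip = θ := by
  cases θ <;> rfl

theorem weight_mirror (a b : ℕ) (θ : Heading) : θ.mirror.weight a b = θ.weight a b := by
  cases θ <;> rfl

theorem weight_flip (a b : ℕ) (θ : Heading) : θ.flip.weight a b = θ.weight a b := by
  cases θ <;> rfl

theorem dx_mirror (θ : Heading) : θ.mirror.dx = -θ.dx := by
  cases θ <;> rfl

theorem dy_mirror (θ : Heading) : θ.mirror.dy = θ.dy := by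
  cases θ <;> rfl

theorem dx_flip (θ : Heading) : θ.flip.dx = θ.dx := by
  cases θ <;> rfl

theorem dy_flip (θ : Heading) : θ.flip.dy = -θ.dy := by
  cases θ <;> rfl

end Heading

section SerpentField

variable {N x y η : ℤ}

/-- A staircase going up to the right in the columns `3` modulo `4`, with a second one going down
next to it, in coordinates that move with the staircase. -/
def staircase (x η : ℤ) : Heading :=
  if (x - 2 * ((η - 1) / 2)) % 4 = 0 then south
  else if (x - 2 * ((η - 1) / 2)) % 4 = 3 then north
  else if η % 2 = 1 then east else west

/-- One block of the direction field `serpent`, for `0 ≤ η < 4 * N`. -/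
def serpentBlock (N x η : ℤ) : Heading :=
  if η = 0 then (if x % 2 = 0 then east else if x % 4 = 1 then north else south)
  else if η < 2 * N then staircase x η
  else if η = 2 * N then
    (if x % 2 = 1 then west else if (x - 2 * N) % 4 = 0 then north else south)
  else (staircase (x + 2) (4 * N - η)).flip

/-- A direction field whose trajectories are curves that fill horizontal blocks of height `4 * N`:
while it advances by `4` in the first coordinate, such a curve climbs through the block and comes
down again. -/
def serpent (N x y : ℤ) : Heading := serpentBlock N x (y % (4 * N))

theorem staircase_south (h : (x - 2 * ((η - 1) / 2)) % 4 = 0) : staircase x η = south := if_pos h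

theorem staircase_north (h : (x - 2 * ((η - 1) / 2)) % 4 = 3) : staircase x η = north := by
  rw [staircase, if_neg (by omega), if_pos h]

theorem staircase_east
    (h : (x - 2 * ((η - 1) / 2)) % 4 = 1 ∨ (x - 2 * ((η - 1) / 2)) % 4 = 2) (hη : η % 2 = 1) :
    staircase x η = east := by
  rw [staircase, if_neg (by omega), if_neg (by omega), if_pos hη]

theorem staircase_west
    (h : (x - 2 * ((η - 1) / 2)) % 4 = 1 ∨ (x - 2 * ((η - 1) / 2)) % 4 = 2) (hη : η % 2 = 0) :
    staircase x η = west := by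
  rw [staircase, if_neg (by omega), if_neg (by omega), if_neg (by omega)]

theorem staircase_add_four (x η : ℤ) : staircase (x + 4) η = staircase x η := by
  have : (x + 4 - 2 * ((η - 1) / 2)) % 4 = (x - 2 * ((η - 1) / 2)) % 4 := by omega
  rw [staircase, staircase, this]

theorem serpent_of_lower (h₀ : 0 < y) (h₁ : y < 2 * N) : serpent N x y = staircase x y := by
  rw [serpent, Int.emod_eq_of_lt (by omega) (by omega), serpentBlock, if_neg (by omega), if_pos h₁]

theorem serpent_of_upper (h₀ : 2 * N < y) (h₁ : y < 4 * N) :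
    serpent N x y = (staircase (x + 2) (4 * N - y)).flip := by
  rw [serpent, Int.emod_eq_of_lt (by omega) (by omega), serpentBlock, if_neg (by omega),
    if_neg (by omega), if_neg (by omega)]

theorem serpent_zero (x : ℤ) :
    serpent N x 0 = if x % 2 = 0 then east else if x % 4 = 1 then north else south := by
  rw [serpent, Int.zero_emod, serpentBlock, if_pos rfl]

theorem serpent_middle (hN : 0 < N) (x : ℤ) :
    serpent N x (2 * N) =
      if x % 2 = 1 then west else if (x - 2 * N) % 4 = 0 then north else south := by
  rw [serpent, Int.emod_eq_of_lt (by omega) (by omega), serpentBlock, if_neg (by omega),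
    if_neg (by omega), if_pos rfl]

theorem serpent_add_mul (x y k : ℤ) : serpent N x (y + 4 * N * k) = serpent N x y := by
  rw [serpent, Int.add_mul_emod_self_left, serpent]

theorem serpent_add_four (x y : ℤ) : serpent N (x + 4) y = serpent N x y := by
  unfold serpent serpentBlock
  rw [staircase_add_four, add_right_comm, staircase_add_four, Int.add_emod_right,
    show (x + 4) % 2 = x % 2 by omega, show (x + 4 - 2 * N) % 4 = (x - 2 * N) % 4 by omega]

theorem serpent_translate (k l x y : ℤ) :
    serpent N (x + 4 * k) (y + 4 * N * l) = serpent N x y := by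
  rw [serpent_add_mul, mul_comm]
  exact Function.Periodic.int_mul (f := fun x => serpent N x y) (fun x => serpent_add_four x y) k x

theorem exists_eq_block_add (hN : 0 < N) (y : ℤ) :
    ∃ η l, 0 ≤ η ∧ η < 4 * N ∧ y = η + 4 * N * l :=
  ⟨y % (4 * N), y / (4 * N), Int.emod_nonneg y (by omega), Int.emod_lt_of_pos y (by omega),
    (Int.emod_add_mul_ediv y (4 * N)).symm⟩

theorem serpent_zero_glide (x : ℤ) : serpent N (x + 2) 0 = (serpent N x 0).flip := by
  rw [serpent_zero, serpent_zero]
  split_ifs <;> first | rfl | omega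

theorem serpent_middle_glide (hN : 0 < N) (x : ℤ) :
    serpent N (x + 2) (2 * N) = (serpent N x (2 * N)).flip := by
  rw [serpent_middle hN, serpent_middle hN]
  split_ifs <;> first | rfl | omega

theorem serpent_block_glide (h₀ : 0 < η) (h₁ : η < 4 * N) (x : ℤ) :
    serpent N (x + 2) (4 * N - η) = (serpent N x η).flip := by
  rcases lt_trichotomy η (2 * N) with h | rfl | h
  · rw [serpent_of_lower h₀ h, serpent_of_upper (by omega) (by omega), sub_sub_cancel, add_assoc]
    exact congrArg Heading.flip (staircase_add_four x η)
  · rw [show 4 * N - 2 * N = 2 * N by ring, serpent_middle_glide (by omega)]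
  · rw [serpent_of_lower (by omega) (by omega), serpent_of_upper h h₁, Heading.flip_flip]

theorem serpent_glide (hN : 0 < N) (x y : ℤ) : serpent N (x + 2) (-y) = (serpent N x y).flip := by
  obtain ⟨η, l, h₀, h₁, rfl⟩ := exists_eq_block_add hN y
  rw [serpent_add_mul]
  rcases h₀.eq_or_lt with rfl | h₀
  · rw [← serpent_zero_glide, ← serpent_add_mul _ 0 (-l)]
    congr 1
    ring
  · rw [← serpent_block_glide h₀ h₁, ← serpent_add_mul _ (4 * N - η) (-l - 1)]
    congr 1
    ring

theorem serpent_reflect (hN : 0 < N) (x y : ℤ) :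
    serpent N x y = (serpent N (x + 2) (4 * N - y)).flip := by
  rw [sub_eq_neg_add, ← mul_one (4 * N), serpent_add_mul, serpent_glide hN, Heading.flip_flip]

end SerpentField

section SerpentRuns

variable {N i h v : ℕ} {x y x' y' η : ℤ}

theorem serpent_run_east (hi : i < N) (H : Run (serpent N) x y h v (1 + 2 * i) (1 + 2 * i)) :
    Run (serpent N) x y (h + 1) v (2 + 2 * i) (1 + 2 * i) := by
  convert H.east (by
    rw [serpent_of_lower (by omega) (by omega), staircase_east (by omega) (by omega)]) using 1
  ring

theorem serpent_run_two_east (hi : i < N) (H : Run (serpent N) x y h v (1 + 2 * i) (1 + 2 * i)) :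
    Run (serpent N) x y (h + 2) v (3 + 2 * i) (1 + 2 * i) := by
  convert (serpent_run_east hi H).east (by
    rw [serpent_of_lower (by omega) (by omega), staircase_east (by omega) (by omega)]) using 1
  ring

theorem serpent_run_two_east_north (hi : i < N)
    (H : Run (serpent N) x y h v (1 + 2 * i) (1 + 2 * i)) :
    Run (serpent N) x y (h + 2) (v + 1) (3 + 2 * i) (2 + 2 * i) := by
  convert (serpent_run_two_east hi H).north (by
    rw [serpent_of_lower (by omega) (by omega), staircase_north (by omega)]) using 1
  ring

theorem serpent_climb_lower (hi : i < N) :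
    Run (serpent N) 0 0 (1 + 2 * i) (1 + 2 * i) (1 + 2 * i) (1 + 2 * i) := by
  induction i with
  | zero =>
    have first : Run (serpent N) 0 0 1 0 1 0 := Run.refl.east (by rw [serpent_zero]; rfl)
    exact first.north (by rw [serpent_zero]; rfl)
  | succ i ih =>
    have := (serpent_run_two_east_north (by omega) (ih (by omega))).north (by
      rw [serpent_of_lower (by omega) (by omega), staircase_north (by omega)])
    convert this using 1 <;> push_cast <;> ring

theorem serpent_run_middle (hN : 0 < N) :
    Run (serpent N) 0 0 (2 * N + 1) (2 * N) (2 * N + 1) (2 * N) := by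
  obtain ⟨n, rfl⟩ := Nat.exists_eq_add_of_le' hN
  have climb := serpent_climb_lower (N := n + 1) (i := n) (by omega)
  have := serpent_run_two_east_north (by omega) climb
  convert this using 1 <;> push_cast <;> ring

theorem serpent_run_middle_west (hN : 0 < N) :
    Run (serpent N) 0 0 (2 * N + 2) (2 * N) (2 * N) (2 * N) := by
  convert (serpent_run_middle hN).west (by
    rw [serpent_middle (by omega), if_pos (by omega)]) using 1
  ring

theorem serpent_run_middle_north (hN : 0 < N) :
    Run (serpent N) 0 0 (2 * N + 2) (2 * N + 1) (2 * N) (2 * N + 1) :=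
  (serpent_run_middle_west hN).north (by
    rw [serpent_middle (by omega), if_neg (by omega), if_pos (by omega)])

theorem serpent_run_middle_two_north (hN : 0 < N) :
    Run (serpent N) 0 0 (2 * N + 2) (2 * N + 2) (2 * N) (2 * N + 2) := by
  convert (serpent_run_middle_north hN).north (by
    rw [serpent_of_upper (by omega) (by omega), staircase_south (by omega)]; rfl) using 1
  ring

theorem serpent_run_west (hi : i + 1 < N)
    (H : Run (serpent N) x y h v (2 * N - 2 * i) (2 * N + 2 + 2 * i)) :
    Run (serpent N) x y (h + 1) v (2 * N - 2 * i - 1) (2 * N + 2 + 2 * i) :=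
  H.west (by rw [serpent_of_upper (by omega) (by omega), staircase_west (by omega) (by omega)]; rfl)

theorem serpent_run_two_west (hi : i + 1 < N)
    (H : Run (serpent N) x y h v (2 * N - 2 * i) (2 * N + 2 + 2 * i)) :
    Run (serpent N) x y (h + 2) v (2 * N - 2 * i - 2) (2 * N + 2 + 2 * i) := by
  convert (serpent_run_west hi H).west (by
    rw [serpent_of_upper (by omega) (by omega), staircase_west (by omega) (by omega)]; rfl) using 1
  ring

theorem serpent_run_two_west_north (hi : i + 1 < N)
    (H : Run (serpent N) x y h v (2 * N - 2 * i) (2 * N + 2 + 2 * i)) :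
    Run (serpent N) x y (h + 2) (v + 1) (2 * N - 2 * i - 2) (2 * N + 3 + 2 * i) := by
  convert (serpent_run_two_west hi H).north (by
    rw [serpent_of_upper (by omega) (by omega), staircase_south (by omega)]; rfl) using 1
  ring

theorem serpent_climb_upper (hi : i < N) :
    Run (serpent N) 0 0 (2 * N + 2 + 2 * i) (2 * N + 2 + 2 * i)
      (2 * N - 2 * i) (2 * N + 2 + 2 * i) := by
  induction i with
  | zero => simpa using serpent_run_middle_two_north hi
  | succ i ih =>
    have := (serpent_run_two_west_north (by omega) (ih (by omega))).north (by
      rw [serpent_of_upper (by omega) (by omega), staircase_south (by omega)]; rfl)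
    convert this using 1 <;> push_cast <;> ring

theorem serpent_half_period (hN : 0 < N) : Run (serpent N) 0 0 (4 * N) (4 * N) 2 (4 * N) := by
  obtain ⟨n, rfl⟩ := Nat.exists_eq_add_of_le' hN
  have := serpent_climb_upper (N := n + 1) (i := n) (by omega)
  convert this using 1 <;> push_cast <;> ring

theorem serpent_run_glide (hN : 0 < N) (H : Run (serpent N) x y h v x' y') :
    Run (serpent N) (x + 2) (-y) h v (x' + 2) (-y') :=
  H.map (f := (· + 2)) weight_flip (fun _ _ => by rw [dx_flip, add_right_comm])
    (fun _ _ => by rw [dy_flip, neg_add]) (serpent_glide (by omega))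

theorem serpent_run_translate (k l : ℤ) (H : Run (serpent N) x y h v x' y') :
    Run (serpent N) (x + 4 * k) (y + 4 * N * l) h v (x' + 4 * k) (y' + 4 * N * l) :=
  H.translate (serpent_translate k l)

theorem serpent_run_half_period_add (hN : 0 < N) (H : Run (serpent N) 0 0 h v x y) :
    Run (serpent N) 0 0 (4 * N + h) (4 * N + v) (x + 2) (4 * N - y) := by
  have glide := serpent_run_translate 0 1 (serpent_run_glide hN H)
  convert (serpent_half_period hN).trans (by simpa using glide) using 1
  ring

theorem serpent_period (hN : 0 < N) (n : ℕ) :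
    Run (serpent N) 0 0 (8 * N * n) (8 * N * n) (4 * n) 0 := by
  induction n with
  | zero => simpa using Run.refl
  | succ n ih =>
    have period := serpent_run_translate n 0
      (serpent_run_half_period_add hN (serpent_half_period hN))
    convert ih.trans (by simpa using period) using 1 <;> push_cast <;> ring

/-- The trajectory of `serpent` through the origin meets the row `y` at a point whose first
coordinate is congruent to `x` modulo the period `4`. -/
def SerpentReaches (N : ℕ) (x y : ℤ) : Prop :=
  ∃ h v x', Run (serpent N) 0 0 h v x' y ∧ 4 ∣ x - x'

/-- The points of the block `0 ≤ η < 4 * N` that are reached from the origin in the first half of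
the period. -/
def SerpentOutward (N x η : ℤ) : Prop :=
  if η = 0 then x % 4 = 0 ∨ x % 4 = 1
  else if η < 2 * N then
    (if η % 2 = 1 then (x - η) % 4 = 0 ∨ (x - η) % 4 = 1 ∨ (x - η) % 4 = 2 else (x - η) % 4 = 1)
  else if η = 2 * N then (x - η) % 4 = 0 ∨ (x - η) % 4 = 1
  else if η % 2 = 1 then (x + η) % 4 = 1
  else (x + η) % 4 = 0 ∨ (x + η) % 4 = 1 ∨ (x + η) % 4 = 2

theorem serpentReaches_bottom (H : x % 4 = 0 ∨ x % 4 = 1) : SerpentReaches N x 0 := by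
  rcases H with H | H
  · exact ⟨_, _, _, .refl, by omega⟩
  · exact ⟨_, _, _, Run.refl.east (by rw [serpent_zero]; rfl), by omega⟩

theorem serpentReaches_lower_odd (hi : i < N)
    (H : (x - (1 + 2 * i)) % 4 = 0 ∨ (x - (1 + 2 * i)) % 4 = 1 ∨ (x - (1 + 2 * i)) % 4 = 2) :
    SerpentReaches N x (1 + 2 * i) := by
  have climb := serpent_climb_lower hi
  rcases H with H | H | H
  · exact ⟨_, _, _, climb, by omega⟩
  · exact ⟨_, _, _, serpent_run_east hi climb, by omega⟩
  · exact ⟨_, _, _, serpent_run_two_east hi climb, by omega⟩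

theorem serpentReaches_lower_even (hi : i < N) (H : (x - (2 + 2 * i)) % 4 = 1) :
    SerpentReaches N x (2 + 2 * i) :=
  ⟨_, _, _, serpent_run_two_east_north hi (serpent_climb_lower hi), by omega⟩

theorem serpentReaches_middle (hN : 0 < N) (H : (x - 2 * N) % 4 = 0 ∨ (x - 2 * N) % 4 = 1) :
    SerpentReaches N x (2 * N) := by
  rcases H with H | H
  · exact ⟨_, _, _, serpent_run_middle_west hN, by omega⟩
  · exact ⟨_, _, _, serpent_run_middle hN, by omega⟩

theorem serpentReaches_upper_odd (hi : i < N) (H : (x + (2 * N + 1 + 2 * i)) % 4 = 1) :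
    SerpentReaches N x (2 * N + 1 + 2 * i) := by
  rcases i with _ | i
  · exact ⟨_, _, _, by simpa using serpent_run_middle_north hi, by omega⟩
  · have run := serpent_run_two_west_north hi (serpent_climb_upper (by omega))
    rw [show (2 * N + 3 + 2 * i : ℤ) = 2 * N + 1 + 2 * (i + 1 : ℕ) by push_cast; ring] at run
    exact ⟨_, _, _, run, by omega⟩

theorem serpentReaches_upper_even (hi : i + 1 < N)
    (H : (x + (2 * N + 2 + 2 * i)) % 4 = 0 ∨ (x + (2 * N + 2 + 2 * i)) % 4 = 1 ∨
      (x + (2 * N + 2 + 2 * i)) % 4 = 2) :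
    SerpentReaches N x (2 * N + 2 + 2 * i) := by
  have climb := serpent_climb_upper (N := N) (i := i) (by omega)
  rcases H with H | H | H
  · exact ⟨_, _, _, serpent_run_two_west hi climb, by omega⟩
  · exact ⟨_, _, _, serpent_run_west hi climb, by omega⟩
  · exact ⟨_, _, _, climb, by omega⟩

theorem SerpentOutward.serpentReaches (h₀ : 0 ≤ η) (h₁ : η < 4 * N) (H : SerpentOutward N x η) :
    SerpentReaches N x η := by
  unfold SerpentOutward at H
  split_ifs at H with bottom lower odd middle odd
  · exact bottom ▸ serpentReaches_bottom H
  · obtain ⟨i, rfl⟩ : ∃ i : ℕ, η = 1 + 2 * i := ⟨((η - 1) / 2).toNat, by omega⟩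
    exact serpentReaches_lower_odd (by omega) H
  · obtain ⟨i, rfl⟩ : ∃ i : ℕ, η = 2 + 2 * i := ⟨((η - 2) / 2).toNat, by omega⟩
    exact serpentReaches_lower_even (by omega) H
  · subst middle
    exact serpentReaches_middle (by omega) H
  · obtain ⟨i, rfl⟩ : ∃ i : ℕ, η = 2 * N + 1 + 2 * i := ⟨((η - 2 * N - 1) / 2).toNat, by omega⟩
    exact serpentReaches_upper_odd (by omega) H
  · obtain ⟨i, rfl⟩ : ∃ i : ℕ, η = 2 * N + 2 + 2 * i := ⟨((η - 2 * N - 2) / 2).toNat, by omega⟩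
    exact serpentReaches_upper_even (by omega) H

theorem serpentOutward_or (h₁ : η < 4 * N) :
    SerpentOutward N x η ∨ SerpentOutward N (x + 2) (if η = 0 then 0 else 4 * N - η) := by
  unfold SerpentOutward
  split_ifs <;> omega

theorem SerpentReaches.half_period (hN : 0 < N) (H : SerpentReaches N (x + 2) y) :
    SerpentReaches N x (4 * N - y) := by
  obtain ⟨h, v, x', run, hx⟩ := H
  exact ⟨_, _, _, serpent_run_half_period_add hN run, by omega⟩

theorem exists_serpentReaches (hN : 0 < N) (x y : ℤ) :
    ∃ l : ℤ, SerpentReaches N x (y + 4 * N * l) := by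
  obtain ⟨η, l, h₀, h₁, rfl⟩ := exists_eq_block_add (N := N) (by omega) y
  rcases serpentOutward_or (x := x) h₁ with H | H
  · refine ⟨-l, ?_⟩
    convert H.serpentReaches h₀ h₁ using 1
    ring
  · have := (H.serpentReaches (by split_ifs <;> omega) (by split_ifs <;> omega)).half_period hN
    split_ifs at this with hη
    · refine ⟨1 - l, ?_⟩
      convert this using 1
      rw [hη]
      ring
    · refine ⟨-l, ?_⟩
      convert this using 1
      ring

end SerpentRuns

section SerpentEdges

variable {N x y η : ℤ}

/-- The horizontal edge to the right of `(x, y)` is used by `serpent`. -/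
def SerpentRight (N x y : ℤ) : Prop := serpent N x y = east ∨ serpent N (x + 1) y = west

/-- The vertical edge above `(x, y)` is used by `serpent`. -/
def SerpentAbove (N x y : ℤ) : Prop := serpent N x y = north ∨ serpent N x (y + 1) = south

theorem serpentRight_add_mul (x y k : ℤ) :
    SerpentRight N x (y + 4 * N * k) ↔ SerpentRight N x y := by
  rw [SerpentRight, serpent_add_mul, serpent_add_mul, SerpentRight]

theorem serpentAbove_add_mul (x y k : ℤ) :
    SerpentAbove N x (y + 4 * N * k) ↔ SerpentAbove N x y := by
  rw [SerpentAbove, add_right_comm, serpent_add_mul, serpent_add_mul, SerpentAbove]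

theorem serpentRight_of_bottom (hx : x % 2 = 0) : SerpentRight N x 0 :=
  Or.inl (by rw [serpent_zero, if_pos hx])

theorem serpentRight_of_middle (hN : 0 < N) (hx : x % 2 = 0) : SerpentRight N x (2 * N) :=
  Or.inr (by rw [serpent_middle hN, if_pos (by omega)])

theorem serpentRight_of_lower (h₀ : 0 < η) (h₁ : η < 2 * N)
    (h : η % 2 = 1 ∧ ((x - η) % 4 = 0 ∨ (x - η) % 4 = 1) ∨
      η % 2 = 0 ∧ ((x - η) % 4 = 2 ∨ (x - η) % 4 = 3)) : SerpentRight N x η := by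
  rcases h with ⟨h, h'⟩ | ⟨h, h'⟩
  · exact Or.inl (by rw [serpent_of_lower h₀ h₁, staircase_east (by omega) h])
  · exact Or.inr (by rw [serpent_of_lower h₀ h₁, staircase_west (by omega) h])

theorem serpentRight_of_upper (h₀ : 2 * N < η) (h₁ : η < 4 * N)
    (h : η % 2 = 1 ∧ ((x + η) % 4 = 2 ∨ (x + η) % 4 = 3) ∨
      η % 2 = 0 ∧ ((x + η) % 4 = 0 ∨ (x + η) % 4 = 1)) : SerpentRight N x η := by
  rcases h with ⟨h, h'⟩ | ⟨h, h'⟩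
  · exact Or.inl (by rw [serpent_of_upper h₀ h₁, staircase_east (by omega) (by omega)]; rfl)
  · exact Or.inr (by rw [serpent_of_upper h₀ h₁, staircase_west (by omega) (by omega)]; rfl)

theorem serpentRight_or_of_lower_half (h₀ : 0 ≤ η) (h₁ : η < 2 * N) (x : ℤ) :
    SerpentRight N x η ∨ SerpentRight N (2 * N + 1 - x) (η + 2 * N) := by
  rcases h₀.eq_or_lt with rfl | h₀
  · rw [zero_add]
    exact (Int.emod_two_eq x).imp serpentRight_of_bottom
      fun h => serpentRight_of_middle (by omega) (by omega)
  · by_cases c : η % 2 = 1 ∧ ((x - η) % 4 = 0 ∨ (x - η) % 4 = 1) ∨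
      η % 2 = 0 ∧ ((x - η) % 4 = 2 ∨ (x - η) % 4 = 3)
    · exact Or.inl (serpentRight_of_lower h₀ h₁ c)
    · exact Or.inr (serpentRight_of_upper (by omega) (by omega) (by omega))

theorem serpentRight_or (hN : 0 < N) (x y : ℤ) :
    SerpentRight N x y ∨ SerpentRight N (2 * N + 1 - x) (y - 2 * N) := by
  obtain ⟨η, l, h₀, h₁, rfl⟩ := exists_eq_block_add hN y
  rcases lt_or_ge η (2 * N) with h | h
  · rw [serpentRight_add_mul, show η + 4 * N * l - 2 * N = η + 2 * N + 4 * N * (l - 1) by ring,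
      serpentRight_add_mul]
    exact serpentRight_or_of_lower_half h₀ h x
  · rw [serpentRight_add_mul, add_sub_right_comm η, serpentRight_add_mul]
    simpa using (serpentRight_or_of_lower_half (N := N) (η := η - 2 * N) (by omega)
      (by omega) (2 * N + 1 - x)).symm

theorem serpentAbove_of_bottom (hN : 0 < N) (hx : x % 4 = 0 ∨ x % 4 = 1) : SerpentAbove N x 0 := by
  rcases hx with hx | hx
  · exact Or.inr (by rw [serpent_of_lower (by omega) (by omega), staircase_south (by omega)])
  · exact Or.inl (by rw [serpent_zero, if_neg (by omega), if_pos hx])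

theorem serpentAbove_of_lower (h₀ : 0 < η) (h₁ : η < 2 * N - 1)
    (h : η % 2 = 1 ∧ ((x - η) % 4 = 3 ∨ (x - η) % 4 = 2) ∨
      η % 2 = 0 ∧ ((x - η) % 4 = 0 ∨ (x - η) % 4 = 1)) : SerpentAbove N x η := by
  rcases h with ⟨h, h' | h'⟩ | ⟨h, h' | h'⟩
  · exact Or.inr (by rw [serpent_of_lower (by omega) (by omega), staircase_south (by omega)])
  · exact Or.inl (by rw [serpent_of_lower (by omega) (by omega), staircase_north (by omega)])
  · exact Or.inr (by rw [serpent_of_lower (by omega) (by omega), staircase_south (by omega)])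
  · exact Or.inl (by rw [serpent_of_lower (by omega) (by omega), staircase_north (by omega)])

theorem serpentAbove_of_below_middle (hN : 0 < N)
    (hx : (x - 2 * N) % 4 = 1 ∨ (x - 2 * N) % 4 = 2) : SerpentAbove N x (2 * N - 1) := by
  rcases hx with hx | hx
  · exact Or.inl (by rw [serpent_of_lower (by omega) (by omega), staircase_north (by omega)])
  · exact Or.inr (by
      rw [sub_add_cancel, serpent_middle hN, if_neg (by omega), if_neg (by omega)])

theorem serpentAbove_reflect (hN : 0 < N) (h : SerpentAbove N (x + 2) (4 * N - y - 1)) :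
    SerpentAbove N x y := by
  rcases h with h | h
  · exact Or.inr (by rw [serpent_reflect hN, ← sub_sub, h]; rfl)
  · exact Or.inl (by rw [serpent_reflect hN, ← sub_add_cancel (4 * N - y) 1, h]; rfl)

/-- The columns in which `serpent` uses the vertical edge above row `η`, for `0 ≤ η < 2 * N`. -/
def SerpentColumns (N x η : ℤ) : Prop :=
  if η = 0 then x % 4 = 0 ∨ x % 4 = 1
  else if η = 2 * N - 1 then (x - 2 * N) % 4 = 1 ∨ (x - 2 * N) % 4 = 2
  else if η % 2 = 1 then (x - η) % 4 = 3 ∨ (x - η) % 4 = 2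
  else (x - η) % 4 = 0 ∨ (x - η) % 4 = 1

theorem SerpentColumns.serpentAbove (h₀ : 0 ≤ η) (h₁ : η < 2 * N) (h : SerpentColumns N x η) :
    SerpentAbove N x η := by
  unfold SerpentColumns at h
  split_ifs at h with bottom below_middle odd
  · exact bottom ▸ serpentAbove_of_bottom (by omega) h
  · exact below_middle ▸ serpentAbove_of_below_middle (by omega) h
  · exact serpentAbove_of_lower (by omega) (by omega) (Or.inl ⟨odd, h⟩)
  · exact serpentAbove_of_lower (by omega) (by omega) (by omega)

theorem serpentAbove_or_of_lower_half (h₀ : 0 ≤ η) (h₁ : η < 2 * N) (x : ℤ) :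
    SerpentAbove N x η ∨ SerpentAbove N (2 * N + 2 - x) (η + 2 * N) := by
  have columns : SerpentColumns N x η ∨ SerpentColumns N (2 * N + 2 - x + 2) (2 * N - η - 1) := by
    unfold SerpentColumns
    split_ifs <;> omega
  refine columns.imp (·.serpentAbove h₀ h₁) fun H => serpentAbove_reflect (by omega) ?_
  convert H.serpentAbove (by omega) (by omega) using 1
  ring

theorem serpentAbove_or (hN : 0 < N) (x y : ℤ) :
    SerpentAbove N x y ∨ SerpentAbove N (2 * N + 2 - x) (y - 2 * N) := by
  obtain ⟨η, l, h₀, h₁, rfl⟩ := exists_eq_block_add hN y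
  rcases lt_or_ge η (2 * N) with h | h
  · rw [serpentAbove_add_mul, show η + 4 * N * l - 2 * N = η + 2 * N + 4 * N * (l - 1) by ring,
      serpentAbove_add_mul]
    exact serpentAbove_or_of_lower_half h₀ h x
  · rw [serpentAbove_add_mul, add_sub_right_comm η, serpentAbove_add_mul]
    simpa using (serpentAbove_or_of_lower_half (N := N) (η := η - 2 * N) (by omega)
      (by omega) (2 * N + 2 - x)).symm

end SerpentEdges

section SerpentPattern

/-- The direction fields of the serpent pattern: `serpent` and its image under a reflection that
shifts the blocks by half their height. -/
def serpentField (N : ℤ) : Bool → ℤ → ℤ → Heading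
  | false, x, y => serpent N x y
  | true, x, y => (serpent N (2 * N + 2 - x) (y - 2 * N)).mirror

/-- The base points of the cycles in the serpent pattern: one for each direction field and each of
the `B` blocks. -/
def serpentBase (N : ℤ) {B : ℕ} : Bool × Fin B → ℤ × ℤ
  | (false, j) => (0, 4 * N * j)
  | (true, j) => (2 * N + 2, 4 * N * j + 2 * N)

theorem serpentField_run_true {N x y x' y' : ℤ} {h v : ℕ} (H : Run (serpent N) x y h v x' y') :
    Run (serpentField N true) (2 * N + 2 - x) (y + 2 * N) h v (2 * N + 2 - x') (y' + 2 * N) :=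
  H.map (f := (2 * N + 2 - ·)) (g := (· + 2 * N)) weight_mirror
    (fun _ _ => by rw [dx_mirror, ← sub_sub, sub_eq_add_neg _ (dx _)])
    (fun _ _ => by rw [dy_mirror, add_right_comm])
    (fun _ _ => by rw [serpentField, sub_sub_cancel, add_sub_cancel_right])

variable {N P B a b : ℕ}

theorem fieldPeriodic_serpentField (c : Bool) :
    FieldPeriodic (4 * P) (4 * N * B) (serpentField N c) where
  fst x y := by
    have periodic (x y k : ℤ) : serpent N (x + 4 * k) y = serpent N x y := by
      simpa using serpent_translate (N := N) k 0 x y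
    push_cast
    cases c
    · exact periodic x y P
    · rw [serpentField, serpentField, ← periodic _ _ P, ← sub_sub, sub_add_cancel]
  snd x y := by
    push_cast
    cases c <;> simp only [serpentField, add_sub_right_comm, serpent_add_mul]

theorem exists_serpentField_east_or_west (hN : 0 < N) (x y : ℤ) :
    ∃ c, serpentField N c x y = east ∨ serpentField N c (x + 1) y = west := by
  rcases serpentRight_or (N := N) (by omega) x y with h | h | h
  · exact ⟨false, h⟩
  · refine ⟨true, Or.inr ?_⟩
    rw [serpentField, show (2 * N + 2 - (x + 1) : ℤ) = 2 * N + 1 - x by ring, h, mirror]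
  · refine ⟨true, Or.inl ?_⟩
    rw [serpentField, show (2 * N + 2 - x : ℤ) = 2 * N + 1 - x + 1 by ring, h, mirror]

theorem exists_serpentField_north_or_south (hN : 0 < N) (x y : ℤ) :
    ∃ c, serpentField N c x y = north ∨ serpentField N c x (y + 1) = south := by
  rcases serpentAbove_or (N := N) (by omega) x y with h | h | h
  · exact ⟨false, h⟩
  · refine ⟨true, Or.inl ?_⟩
    rw [serpentField, h, mirror]
  · refine ⟨true, Or.inr ?_⟩
    rw [serpentField, show (y + 1 - 2 * N : ℤ) = y - 2 * N + 1 by ring, h, mirror]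

theorem exists_serpent_run_torusMk (hN : 0 < N) (hP : 0 < P) (hB : 0 < B) (x y : ℤ) :
    ∃ (j : Fin B) (h v : ℕ) (x' y' : ℤ), Run (serpent N) 0 (4 * N * j) h v x' y' ∧
      torusMk (4 * P) (4 * N * B) (x', y') = torusMk (4 * P) (4 * N * B) (x, y) := by
  obtain ⟨l, h, v, x₁, run, k, hk⟩ := exists_serpentReaches hN x y
  have hj := Int.emod_nonneg (-l) (b := B) (by omega)
  have hj' := Int.emod_lt_of_pos (-l) (b := B) (by omega)
  have ej := Int.mul_ediv_add_emod (-l) B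
  have hm := Int.emod_nonneg k (b := P) (by omega)
  have em := Int.mul_ediv_add_emod k P
  generalize -l % (B : ℤ) = j at hj hj' ej
  generalize k % (P : ℤ) = m at hm em
  lift j to ℕ using hj
  lift m to ℕ using hm
  have run' := (serpent_period hN m).trans (by simpa using serpent_run_translate m 0 run)
  refine ⟨⟨j, by omega⟩, _, _, _, _, by simpa using serpent_run_translate 0 j run', ?_⟩
  refine torusMk_eq_iff.2 ⟨⟨k / P, ?_⟩, ⟨-l / B, ?_⟩⟩
  · push_cast
    linear_combination hk - 4 * em
  · push_cast
    linear_combination -4 * N * ej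

theorem serpentField_reach (hN : 0 < N) (hP : 0 < P) (hB : 0 < B) (c : Bool) (x y : ℤ) :
    ∃ (k : Bool × Fin B) (h v : ℕ) (x' y' : ℤ), k.1 = c ∧
      Run (serpentField N c) (serpentBase N k).1 (serpentBase N k).2 h v x' y' ∧
      torusMk (4 * P) (4 * N * B) (x', y') = torusMk (4 * P) (4 * N * B) (x, y) := by
  cases c
  · obtain ⟨j, h, v, x', y', run, e⟩ := exists_serpent_run_torusMk hN hP hB x y
    exact ⟨(false, j), h, v, x', y', rfl, run, e⟩
  · obtain ⟨j, h, v, x', y', run, e⟩ :=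
      exists_serpent_run_torusMk hN hP hB (2 * N + 2 - x) (y - 2 * N)
    refine ⟨(true, j), h, v, _, _, rfl, by simpa [serpentBase] using serpentField_run_true run, ?_⟩
    rw [torusMk_eq_iff] at e ⊢
    refine ⟨(dvd_neg.2 e.1).trans (dvd_of_eq (by ring)), e.2.trans (dvd_of_eq (by ring))⟩

theorem serpent_run_return (hN : 0 < N) (P j : ℕ) :
    Run (serpent N) 0 (4 * N * j) (4 * P * (2 * N)) (4 * P * (2 * N)) (4 * P) (4 * N * j) := by
  convert serpent_run_translate 0 j (serpent_period hN P) using 1 <;> ring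

theorem serpentField_return (hN : 0 < N) (k : Bool × Fin B) :
    ∃ x y, Run (serpentField N k.1) (serpentBase N k).1 (serpentBase N k).2
      (4 * P * (2 * N)) (4 * P * (2 * N)) x y ∧
      torusMk (4 * P) (4 * N * B) (x, y) = torusMk (4 * P) (4 * N * B) (serpentBase N k) := by
  rcases k with ⟨_ | _, j⟩
  · exact ⟨_, _, serpent_run_return hN P j, torusMk_eq_iff.2 (by simp)⟩
  · exact ⟨_, _, by simpa [serpentBase] using serpentField_run_true (serpent_run_return hN P j),
      torusMk_eq_iff.2 (by simp)⟩

theorem isTorusPattern_serpentField (hN : 0 < N) (hP : 0 < P) (hB : 0 < B) :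
    IsTorusPattern (4 * P) (4 * N * B) (4 * P * (2 * N)) (serpentField N) Prod.fst
      (serpentBase N (B := B)) where
  periodic := fieldPeriodic_serpentField
  cover_fst := exists_serpentField_east_or_west hN
  cover_snd := exists_serpentField_north_or_south hN
  reach := serpentField_reach hN hP hB
  ret := serpentField_return hN
  card := by
    rw [Nat.card_prod, Nat.card_fin, Nat.card_eq_fintype_card, Fintype.card_bool]
    ring

theorem tiles_serpents (hN : 0 < N) (hP : 0 < P) (hB : 0 < B) (ha : 0 < a) (hb : 0 < b) :
    Tiles (zmodCycle (4 * P * (2 * N) * (a + b))) (subdividedTorus (4 * P) (4 * N * B) a b) := by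
  have : NeZero (4 * P) := ⟨by positivity⟩
  have : NeZero (4 * N * B) := ⟨by positivity⟩
  have : NeZero a := ⟨ha.ne'⟩
  have : NeZero b := ⟨hb.ne'⟩
  have hPa : 0 < P * a := by positivity
  have hNBb : 0 < N * B * b := by positivity
  exact ⟨Bool × Fin B, inferInstance, _,
    (isTorusPattern_serpentField hN hP hB).isTiling (by linarith) (by linarith)⟩

end SerpentPattern

section Assembly

theorem two_pow_even {n : ℕ} (hn : 1 ≤ n) : Even (2 ^ n) :=
  Nat.even_pow.2 ⟨even_two, Nat.one_le_iff_ne_zero.1 hn⟩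

theorem three_le_two_pow_mul {n c : ℕ} (hn : 2 ≤ n) (hc : 0 < c) : 3 ≤ 2 ^ n * c :=
  calc 3 ≤ 2 ^ 2 * 1 := by norm_num
    _ ≤ 2 ^ n * c := Nat.mul_le_mul (Nat.pow_le_pow_right two_pos hn) hc

theorem anchoredCycles_subdividedTorus_two_pow {E t e a b : ℕ} (hE : 2 ≤ E) (ht : 1 ≤ t)
    (he : e = 0 ∨ e = t - 1) (ha : 0 < a) (hbt : 3 ≤ 2 ^ t * b) :
    AnchoredCycles (2 ^ (E + e)) (a + b) (subdividedTorus (2 ^ E) (2 ^ t) a b)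
      (gridVertices (2 ^ E) (2 ^ t) a b) := by
  have hp : Even (2 ^ E) := two_pow_even (one_le_two.trans hE)
  rcases he with rfl | rfl
  · exact anchoredCycles_strips hp (two_pow_even ht) (three_le_two_pow_mul hE ha) hbt
  · obtain ⟨t, rfl⟩ := Nat.exists_eq_add_of_le' ht
    rw [Nat.add_sub_cancel, pow_add]
    rw [pow_succ'] at hbt ⊢
    exact anchoredCycles_spirals hp (three_le_two_pow_mul hE ha) hbt

theorem tiles_subdividedTorus_two_pow {E t e a b : ℕ} (hE : 2 ≤ E) (ht : 1 ≤ t) (he : e ≤ t - 1)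
    (ha : 0 < a) (hbt : 3 ≤ 2 ^ t * b) :
    Tiles (zmodCycle (2 ^ (E + e) * (a + b))) (subdividedTorus (2 ^ E) (2 ^ t) a b) := by
  rcases e with _ | e
  · exact (anchoredCycles_subdividedTorus_two_pow hE ht (Or.inl rfl) ha hbt).tiles
  · obtain ⟨P, rfl⟩ := Nat.exists_eq_add_of_le hE
    obtain ⟨B, rfl⟩ := Nat.exists_eq_add_of_le (show 2 + e ≤ t by omega)
    have h := tiles_serpents (N := 2 ^ e) (P := 2 ^ P) (B := 2 ^ B) (by positivity)
      (by positivity) (by positivity) ha (Nat.pos_of_mul_pos_left (Nat.zero_lt_of_lt hbt))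
    rwa [show 4 * 2 ^ P = 2 ^ (2 + P) by ring, show 4 * 2 ^ e * 2 ^ B = 2 ^ (2 + e + B) by ring,
      show 2 ^ (2 + P) * (2 * 2 ^ e) = 2 ^ (2 + P + (e + 1)) by ring] at h

variable {ι : Type*} [DecidableEq ι]

theorem exists_eq_sum_erase_add {s : Finset ι} (hs : s.Nonempty) (c : ι → ℕ) {g : ℕ}
    (hg : g ≤ ∑ j ∈ s, c j) :
    ∃ j ∈ s, ∃ (f : ι → ℕ) (e : ℕ), (∀ k ∈ s.erase j, f k = 0 ∨ f k = c k) ∧ e ≤ c j ∧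
      g = ∑ k ∈ s.erase j, f k + e := by
  induction hs using Finset.Nonempty.cons_induction with
  | singleton j => exact ⟨j, by simp, c, g, by simp, by simpa using hg, by simp⟩
  | cons j s hj _ ih =>
    rw [Finset.sum_cons] at hg
    simp only [Finset.cons_eq_insert]
    by_cases h : g ≤ ∑ k ∈ s, c k
    · obtain ⟨i, hi, f, e, hf, he, rfl⟩ := ih h
      have hij : j ≠ i := fun h => hj (h ▸ hi)
      have hji : j ∉ s.erase i := fun h => hj (Finset.mem_of_mem_erase h)
      have congr : ∀ k ∈ s.erase i, Function.update f j 0 k = f k := fun k hk =>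
        Function.update_of_ne (ne_of_mem_of_not_mem hk hji) 0 f
      refine ⟨i, Finset.mem_insert_of_mem hi, Function.update f j 0, e, ?_, he, ?_⟩ <;>
        rw [Finset.erase_insert_of_ne hij]
      · rw [Finset.forall_mem_insert, Function.update_self]
        exact ⟨Or.inl rfl, fun k hk => congr k hk ▸ hf k hk⟩
      · rw [Finset.sum_insert hji, Function.update_self, zero_add, Finset.sum_congr rfl congr]
    · refine ⟨j, Finset.mem_insert_self j s, c, g - ∑ k ∈ s, c k, fun _ _ => Or.inr rfl,
        by omega, ?_⟩
      rw [Finset.erase_insert hj]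
      omega

variable {V : ι → Type*} {G : ∀ j, SimpleGraph (V j)} {S : ∀ j, Set (V j)} {o : ∀ j, V j}
  {b t : ι → ℕ} {j₀ : ι}

theorem sum_insert_pos (hbt : ∀ j, 3 ≤ 2 ^ t j * b j) (i : ι) (s : Finset ι) :
    0 < ∑ j ∈ insert i s, b j :=
  Finset.sum_pos (fun j _ => Nat.pos_of_mul_pos_left (Nat.zero_lt_of_lt (hbt j)))
    (Finset.insert_nonempty i s)

theorem anchoredCycles_partialProd {f : ι → ℕ} {s : Finset ι} (ht : ∀ j, 1 ≤ t j)
    (hbt : ∀ j, 3 ≤ 2 ^ t j * b j)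
    (hG : ∀ j, AnchoredCycles (2 ^ t j) (b j) (G j) (S j)) (ht₀ : 2 ≤ t j₀) (hs : j₀ ∉ s)
    (hf : ∀ j ∈ s, f j = 0 ∨ f j = t j - 1) :
    AnchoredCycles (2 ^ (t j₀ + ∑ j ∈ s, f j)) (∑ j ∈ insert j₀ s, b j)
      (partialProd G S o (insert j₀ s)) (univ.pi (partialAnchors S o (insert j₀ s))) := by
  induction s using Finset.induction_on with
  | empty =>
    simpa using (hG j₀).trans (anchoredTiles_partialProd_singleton (hG j₀).subset_support)
  | insert j s hj ih =>
    rw [Finset.mem_insert, not_or] at hs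
    rw [Finset.forall_mem_insert] at hf
    have hj' : j ∉ insert j₀ s := by
      rw [Finset.mem_insert, not_or]
      exact ⟨Ne.symm hs.1, hj⟩
    have torus := anchoredCycles_subdividedTorus_two_pow (E := t j₀ + ∑ k ∈ s, f k) (by omega)
      (ht j) hf.1 (sum_insert_pos hbt j₀ s) (hbt j)
    rw [Finset.insert_comm, Finset.sum_insert hj', Finset.sum_insert hj, add_comm (b j),
      add_comm (f j), ← add_assoc]
    exact (torus.trans ((ih hs.2 hf.2).box (hG j))).trans
      (anchoredTiles_partialProd_insert hj' (hG j).subset_support)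

theorem tiles_anchoredPi [Fintype ι] {g : ℕ} (ht : ∀ j, 1 ≤ t j)
    (hbt : ∀ j, 3 ≤ 2 ^ t j * b j) (hG : ∀ j, AnchoredCycles (2 ^ t j) (b j) (G j) (S j))
    (ht₀ : 2 ≤ t j₀) (hg : g ≤ ∑ j ∈ Finset.univ.erase j₀, (t j - 1)) (o : ∀ j, V j) :
    Tiles (zmodCycle (2 ^ (t j₀ + g) * ∑ j, b j)) (anchoredPi G S) := by
  rw [← partialProd_univ (o := o)]
  rcases (Finset.univ.erase j₀).eq_empty_or_nonempty with h₀ | h₀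
  · rw [h₀, Finset.sum_empty, Nat.le_zero] at hg
    have h := anchoredCycles_partialProd (o := o) (f := 0) ht hbt hG ht₀
      (Finset.notMem_empty j₀) (by simp)
    rw [Finset.sum_empty, ← h₀, Finset.insert_erase (Finset.mem_univ j₀)] at h
    exact hg ▸ h.tiles
  · obtain ⟨j, hj, f, e, hf, he, rfl⟩ := exists_eq_sum_erase_add h₀ _ hg
    set s := (Finset.univ.erase j₀).erase j with hs
    have hj' : j ∉ insert j₀ s := by simp [hs, Finset.ne_of_mem_erase hj]
    have hu : insert j (insert j₀ s) = Finset.univ := by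
      rw [Finset.insert_comm, hs, Finset.insert_erase hj, Finset.insert_erase (Finset.mem_univ _)]
    have torus := tiles_subdividedTorus_two_pow (E := t j₀ + ∑ k ∈ s, f k) (by omega) (ht j) he
      (sum_insert_pos hbt j₀ s) (hbt j)
    rw [← hu, Finset.sum_insert hj', add_comm (b j), ← add_assoc]
    have h := anchoredCycles_partialProd (o := o) ht hbt hG ht₀ (by simp [hs]) hf
    exact (torus.trans (h.box (hG j)).tiles).trans
      (anchoredTiles_partialProd_insert hj' (hG j).subset_support).tiles

end Assembly

theorem lemma6_general {ι : Type} [Fintype ι] [DecidableEq ι] {y b t : ι → ℕ} {α : ℕ}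
    (hy : ∀ j, y j = 2 ^ t j * b j) (hy₃ : ∀ j, 3 ≤ y j) (ht : ∀ j, 1 ≤ t j) (j₀ : ι)
    (ht₀ : 2 ≤ t j₀) (hα₀ : t j₀ ≤ α) (hα : α ≤ t j₀ + ∑ j ∈ Finset.univ.erase j₀, (t j - 1)) :
    Decomposes (cycleGraph ((∑ j, b j) * 2 ^ α))
      (anchoredProd (fun j => cycleGraph (y j)) (fun j => everyNth (y j) (b j))) := by
  obtain ⟨g, rfl⟩ := Nat.exists_eq_add_of_le hα₀
  obtain rfl : y = fun j => 2 ^ t j * b j := funext hy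
  have hb (j) : 0 < b j := Nat.pos_of_mul_pos_left (Nat.zero_lt_of_lt (hy₃ j))
  have (j : ι) : NeZero (2 ^ t j * b j) := ⟨(Nat.zero_lt_of_lt (hy₃ j)).ne'⟩
  have : Nonempty ι := ⟨j₀⟩
  have : Nonempty (AnchoredVertex fun j => everyNth (2 ^ t j * b j) (b j)) :=
    ⟨fun _ => 0, fun _ _ _ => Or.inl (dvd_zero _)⟩
  have hn : 3 ≤ 2 ^ (t j₀ + g) * ∑ j, b j := three_le_two_pow_mul (by omega)
    (Finset.sum_pos (fun j _ => hb j) Finset.univ_nonempty)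
  have cycles := tiles_anchoredPi ht hy₃
    (fun j => anchoredTiles_cycleGraph (le_of_lt (hy₃ j)) (b j)) ht₀
    (Nat.add_le_add_iff_left.1 hα) fun _ => 0
  rw [mul_comm]
  exact (tiles_anchoredProd ((tiles_cycleGraph_iff (by omega)).2 cycles)
    (support_cycleGraph (by omega))).decomposes (support_cycleGraph (by omega))
    (anchoredProd_support fun j => support_cycleGraph (le_of_lt (hy₃ j)))

section PowersOfTwo

variable {d y z k : ℕ}

theorem two_pow_log_of_mul_two_pow (hy : ∃ e, y = 2 ^ e) (hz : y = z * 2 ^ k) :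
    2 ^ Nat.log 2 z = z := by
  obtain ⟨e, rfl⟩ := hy
  obtain ⟨t, -, rfl⟩ := (Nat.dvd_prime_pow Nat.prime_two).1 (Dvd.intro _ hz.symm)
  rw [Nat.log_pow one_lt_two]

theorem one_le_log_of_even (h : Even z) (hz : z ≠ 0) : 1 ≤ Nat.log 2 z :=
  Nat.log_pos one_lt_two (Nat.le_of_dvd hz.bot_lt h.two_dvd)

theorem alphaMax_one (d : ℕ) (z : ℕ → ℕ) : alphaMax d z 1 = Nat.log 2 (z d) := by
  simp [alphaMax]

theorem alphaMax_self {z : ℕ → ℕ} (hd : d ∈ Finset.Icc 1 d)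
    (hz : ∀ j ∈ Finset.Icc 1 d, 1 ≤ Nat.log 2 (z j)) :
    alphaMax d z d = Nat.log 2 (z d) +
      ∑ j ∈ Finset.univ.erase (⟨d, hd⟩ : Finset.Icc 1 d), (Nat.log 2 (z j) - 1) := by
  have erase := Finset.add_sum_erase Finset.univ (fun j : Finset.Icc 1 d => Nat.log 2 (z j) - 1)
    (Finset.mem_univ ⟨d, hd⟩)
  obtain ⟨n, rfl⟩ := Nat.exists_eq_add_of_le' (Finset.mem_Icc.1 hd).1
  rw [Finset.sum_coe_sort (Finset.Icc 1 (n + 1)) fun j => Nat.log 2 (z j) - 1,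
    Finset.sum_Icc_succ_top (by omega), add_comm] at erase
  have hsum : ∑ j ∈ Finset.Icc 1 n, (Nat.log 2 (z j) - 1) + n =
      ∑ j ∈ Finset.Icc 1 n, Nat.log 2 (z j) := by
    rw [← Finset.sum_congr rfl fun j hj => Nat.sub_add_cancel (hz j (Finset.Icc_subset_Icc_right
      n.le_succ hj)), Finset.sum_add_distrib]
    simp
  rw [alphaMax, Nat.add_sub_cancel, Nat.add_right_cancel erase, ← hsum]
  omega

end PowersOfTwo

theorem lemma6 (d a α : ℕ) (i y z : ℕ → ℕ) (hd : 2 ≤ d)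
    (hi : ∀ j ∈ Finset.Icc 1 d, ∀ k ∈ Finset.Icc 1 d, j < k → i k < i j)
    (hid : i d = 0)
    (ha : a = ∑ j ∈ Finset.Icc 1 d, 2 ^ i j)
    (hy : ∀ j ∈ Finset.Icc 1 d, 4 ≤ y j ∧ ∃ e : ℕ, y j = 2 ^ e)
    (hz : ∀ j ∈ Finset.Icc 1 d, y j = z j * 2 ^ i j)
    (hzeven : ∀ j ∈ Finset.Icc 1 d, Even (z j))
    (hα₁ : alphaMax d z 1 ≤ α)
    (hαd : α ≤ alphaMax d z d)
    (hdvdd : 4 ∣ y d)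
    (hdvd₁ : A3 d z α * 2 ^ i 1 ∣ y 1)
    (hdvd : ∀ j ∈ Finset.Icc 2 (d - 1), AFactor d z α (j + 2) * 2 ^ (i j + 1) ∣ y j) :
    Decomposes (SimpleGraph.cycleGraph (a * 2 ^ α))
      (anchoredProd (fun j : Finset.Icc 1 d => SimpleGraph.cycleGraph (y j))
        (fun j : Finset.Icc 1 d => everyNth (y j) (2 ^ i j))) := by
  have hlog : ∀ j ∈ Finset.Icc 1 d, 1 ≤ Nat.log 2 (z j) := fun j hj =>
    one_le_log_of_even (hzeven j hj) fun h => by simpa [hz j hj, h] using (hy j hj).1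
  have hd' : d ∈ Finset.Icc 1 d := Finset.mem_Icc.2 ⟨one_le_two.trans hd, le_rfl⟩
  have hlogd : 2 ≤ Nat.log 2 (z d) :=
    Nat.le_log_of_pow_le one_lt_two (by simpa [hz d hd', hid] using (hy d hd').1)
  rw [alphaMax_one] at hα₁
  rw [alphaMax_self hd' hlog] at hαd
  rw [ha, ← Finset.sum_coe_sort (Finset.Icc 1 d) fun j => 2 ^ i j]
  exact lemma6_general (t := fun j : Finset.Icc 1 d => Nat.log 2 (z j))
    (fun j => by rw [two_pow_log_of_mul_two_pow (hy j j.2).2 (hz j j.2), hz j j.2])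
    (fun j => (by norm_num : 3 ≤ 4).trans (hy j j.2).1) (fun j => hlog j j.2) ⟨d, hd'⟩ hlogd hα₁ hαd
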